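/- Let $\kappa>0$ and let $q:\mathbb S^2\to\mathbb R^3$ be an injective $C^2$ map of the unit sphere. Let $p(\theta,\varphi)=(\sin\theta\cos\varphi,\sin\theta\sin\varphi,\cos\theta)^\top$ be spherical coordinates, with orthonormal tangent vectors $e_\theta=\partial_\theta p$ and $e_\varphi=\frac1{\sin\theta}\partial_\varphi p$ (at the two poles the value $\varphi=0$ is used, $e_\varphi=(0,1,0)^\top$, and $e_\theta=e_\varphi\times\hat x$). Let $t_1,t_2$ be the derivatives of $q$ in the directions $e_\theta,e_\varphi$, i.e. $t_1=\partial_\theta(q\circ p)$ and $t_2=\frac1{\sin\theta}\partial_\varphi(q\circ p)$ away from the poles, and put $$J_q=|t_1\times t_2|,\qquad \nu\circ q=\frac{t_1\times t_2}{J_q},\qquad [\mathbf D_{\mathbb S^2}q]=t_1e_\theta^\top+t_2e_\varphi^\top .$$ Assume that $J_q$ vanishes nowhere. Let $\Gamma=q(\mathbb S^2)$, with surface measure $ds$ characterized by $\int_\Gamma f\,ds=\int_{\mathbb S^2}(f\circ q)\,J_q\,ds$. For a complex function $w$ on $\mathbb S^2$ put $\mathbf{Grad}_{\mathbb S^2}w=(\partial_\theta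 w)\,e_\theta+\frac1{\sin\theta}(\partial_\varphi w)\,e_\varphi$ and $\mathbf{curl}_{\mathbb S^2}w=(\mathbf{Grad}_{\mathbb S^2}w)\times\hat x$. For $\boldsymbol\varphi:\mathbb S^2\to\mathbb C^3$ let $\mathbf{curl}_{\mathbb S^2}\boldsymbol\varphi$ be the matrix whose $j$-th column is $\mathbf{curl}_{\mathbb S^2}\varphi_j$. For $3\times3$ matrices let $A:B=\sum_{i,j}A_{ij}B_{ij}$. Let $(u,v)=\int_{\mathbb S^2}u\cdot\overline v\,ds$. Let $\Phi(x,y)=\dfrac{e^{i\kappa|x-y|}}{4\pi|x-y|}$, let $g:\Gamma\to\mathbb C$ be continuous, $G=g\circ q$, and $V(x)=\int_\Gamma\Phi(x,y)g(y)\,ds(y)$ for $x\in\mathbb R^3$. Define for $x\in\Gamma$ $$(Hg)(x)=2\,\nu(x)\times\nabla_x\int_\Gamma\Phi(x,y)g(y)\,ds(y):=\lim_{h\to0+}2\,\nu(x)\times\nabla V(x+h\nu(x)).$$ Define for $\hat x\in\mathbb S^2$ $$(\mathcal S^{\mathfrak p}G)(\hat x)=\int_{\mathbb S^2}\Big(\frac{1}{|\hat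 x-\hat y|}\,R(\hat x,\hat y)\,s_1(q(\hat x),q(\hat y))+s_2(q(\hat x),q(\hat y))\Big)J_q(\hat y)\,G(\hat y)\,ds(\hat y),$$ where $R(\hat x,\hat y)=\frac{|\hat x-\hat y|}{|q(\hat x)-q(\hat y)|}$, $s_1(x,y)=\frac{\cos(\kappa|x-y|)}{2\pi}$, $s_2(x,y)=\frac{i\sin(\kappa|x-y|)}{2\pi|x-y|}$ for $x\ne y$, and $s_2(x,x)=\frac{i\kappa}{2\pi}$. **Theorem 4.2.** 1. If $g$ is Hölder continuous on $\Gamma$ with some exponent $\alpha\in(0,1]$, then $2\,\nu(x)\times\nabla V(x+h\nu(x))$ converges to $(Hg)(x)$, uniformly in $x\in\Gamma$, as $h\to0$ from either side. 2. Let $g$ be continuous on $\Gamma$ and such that the limit (as $h\to0+$) defining $Hg$ exists uniformly on $\Gamma$; by part 1 this holds for every Hölder continuous $g$. Then for every $C^\infty$ vector function $\boldsymbol\varphi:\mathbb S^2\to\mathbb C^3$ both integrals below converge absolutely, and $$\big(J_q\,(Hg)\circ q,\ \boldsymbol\varphi\big)=\big(\mathcal S^{\mathfrak p}G,\ [\mathbf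 D_{\mathbb S^2}q]^\top:\mathbf{curl}_{\mathbb S^2}\boldsymbol\varphi\big).$$ -/

import Mathlib

open Filter Topology MeasureTheory
open scoped Manifold ContDiff Matrix ComplexConjugate

/-- Euclidean space `ℝ³`. -/
abbrev E3 : Type := EuclideanSpace ℝ (Fin 3)

/-- The unit sphere `S² ⊂ ℝ³`. -/
abbrev S2 : Type := Metric.sphere (0 : E3) 1

/-- The dimension fact that gives `S2` its standard smooth structure. -/
instance factFinrankE3 : Fact (Module.finrank ℝ E3 = 2 + 1) := ⟨by simp⟩

noncomputable section

/-- The standard surface measure `ds` on `S²`. -/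
def sphereMeasure : Measure S2 := (volume : Measure E3).toSphere

/-- A real vector regarded as a vector of `ℂ³`. -/
def toC3 (v : E3) : Fin 3 → ℂ := fun i => (v i : ℂ)

/-- The cross product of `ℝ³`. -/
def cross3 (a b : E3) : E3 := WithLp.toLp 2 (crossProduct (a : Fin 3 → ℝ) (b : Fin 3 → ℝ))

/-- The unit vector `e_φ = (-sin φ, cos φ, 0)` at a point of the sphere with spherical coordinates
`(θ, φ)`. At the two poles the coordinate value `φ = 0` is used. -/
def ePhi (x : S2) : E3 :=
  if (x : E3) 0 = 0 ∧ (x : E3) 1 = 0 then !₂[0, 1, 0]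
  else (Real.sqrt ((x : E3) 0 ^ 2 + (x : E3) 1 ^ 2))⁻¹ • !₂[-(x : E3) 1, (x : E3) 0, 0]

/-- The unit vector `e_θ = (cos θ cos φ, cos θ sin φ, -sin θ)`, which is `e_φ × x`. -/
def eTheta (x : S2) : E3 := cross3 (ePhi x) (x : E3)

/-- The extension `x ↦ f (x / |x|)` of a function on `S²` to `ℝ³ ∖ {0}`, constant along rays. -/
def radialExt {F : Type*} [Zero F] (f : S2 → F) (x : E3) : F :=
  if h : x = 0 then 0
  else f ⟨‖x‖⁻¹ • x, by
    rw [mem_sphere_zero_iff_norm, norm_smul, norm_inv, norm_norm,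
      inv_mul_cancel₀ (norm_ne_zero_iff.mpr h)]⟩

/-- The derivative at `x ∈ S²` of a function on `S²` in the direction of the tangent vector `v`.
In spherical coordinates it is `∂/∂θ` for `v = e_θ` and `(1 / sin θ) ∂/∂φ` for `v = e_φ`. -/
def sphereDeriv {F : Type*} [NormedAddCommGroup F] [NormedSpace ℝ F] (f : S2 → F) (x : S2)
    (v : E3) : F :=
  fderiv ℝ (radialExt f) (x : E3) v

/-- The surface gradient on `S²` of a complex-valued function:
`(∂w/∂θ) e_θ + (1 / sin θ) (∂w/∂φ) e_φ`. -/
def gradS2 (w : S2 → ℂ) (x : S2) : Fin 3 → ℂ :=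
  sphereDeriv w x (eTheta x) • toC3 (eTheta x) + sphereDeriv w x (ePhi x) • toC3 (ePhi x)

/-- The vector surface curl of a scalar function on `S²`: `(Grad w) × x`. -/
def curlS2 (w : S2 → ℂ) (x : S2) : Fin 3 → ℂ :=
  crossProduct (gradS2 w x) (toC3 (x : E3))

/-- The surface curl of a vector function on `S²`: the matrix whose `j`-th column is the
surface curl of the `j`-th component. -/
def curlMatS2 (f : S2 → Fin 3 → ℂ) (x : S2) : Matrix (Fin 3) (Fin 3) ℂ :=
  Matrix.of fun i j => curlS2 (fun y => f y j) x i

/-- The product `A : B = a₁ · b₁ + a₂ · b₂ + a₃ · b₃` of matrices with columns `aⱼ`, `bⱼ`. -/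
def matColon (A B : Matrix (Fin 3) (Fin 3) ℂ) : ℂ := ∑ j, A.col j ⬝ᵥ B.col j

/-- The tangent vector `t₁ = ∂(q ∘ p)/∂θ`. -/
def t1 (q : S2 → E3) (x : S2) : E3 := sphereDeriv q x (eTheta x)

/-- The tangent vector `t₂ = (1 / sin θ) ∂(q ∘ p)/∂φ`. -/
def t2 (q : S2 → E3) (x : S2) : E3 := sphereDeriv q x (ePhi x)

/-- The matrix `D q = t₁ ⊗ e_θ + t₂ ⊗ e_φ`. -/
def DS2 (q : S2 → E3) (x : S2) : Matrix (Fin 3) (Fin 3) ℝ :=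
  Matrix.vecMulVec (t1 q x : Fin 3 → ℝ) (eTheta x : Fin 3 → ℝ) +
    Matrix.vecMulVec (t2 q x : Fin 3 → ℝ) (ePhi x : Fin 3 → ℝ)

/-- The Jacobian `J_q = |t₁ × t₂|`. -/
def Jac (q : S2 → E3) (x : S2) : ℝ := ‖cross3 (t1 q x) (t2 q x)‖

/-- The unit normal `ν ∘ q = (t₁ × t₂) / J_q`, as a function on `S²`. -/
def normalQ (q : S2 → E3) (x : S2) : E3 := (Jac q x)⁻¹ • cross3 (t1 q x) (t2 q x)

instance nonemptyS2 : Nonempty S2 :=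
  ⟨⟨EuclideanSpace.single 0 1, by simp⟩⟩

/-- The unit normal `ν` on the surface `Γ = q(S²)`, for injective `q`. -/
def normal (q : S2 → E3) (x : E3) : E3 := normalQ q (Function.invFun q x)

/-- The surface measure `ds` of the surface `Γ = q(S²)`, as a measure on `ℝ³` carried by `Γ`. -/
def surfaceMeasure (q : S2 → E3) : Measure E3 :=
  (sphereMeasure.withDensity fun x => ENNReal.ofReal (Jac q x)).map q

/-- The fundamental solution `e^{iκ|x-y|} / (4π|x-y|)` of the Helmholtz equation. -/
def Phi (κ : ℝ) (x y : E3) : ℂ :=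
  (1 / (4 * Real.pi) : ℂ) * (Complex.exp (Complex.I * κ * ‖x - y‖) / ‖x - y‖)

/-- The single-layer potential `x ↦ ∫_Γ Φ(x, y) g(y) ds(y)` on `ℝ³`. -/
def layerPotential (κ : ℝ) (q : S2 → E3) (g : E3 → ℂ) (x : E3) : ℂ :=
  ∫ y, Phi κ x y * g y ∂(surfaceMeasure q)

/-- The gradient of a complex-valued function on `ℝ³`. -/
def gradC (f : E3 → ℂ) (x : E3) : Fin 3 → ℂ :=
  fun i => fderiv ℝ f x (EuclideanSpace.single i 1)

/-- `2 ν(x) × ∇V(x + hν(x))`, where `V` is the single-layer potential with density `g`. -/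
def tangentialGradAt (κ : ℝ) (q : S2 → E3) (g : E3 → ℂ) (h : ℝ) (x : E3) : Fin 3 → ℂ :=
  (2 : ℂ) • crossProduct (toC3 (normal q x))
    (gradC (layerPotential κ q g) (x + h • normal q x))

/-- The boundary operator `(Hg)(x) = 2 ν(x) × ∇ₓ ∫_Γ Φ(x, y) g(y) ds(y)`, `x ∈ Γ`. The gradient at
a point of `Γ` is the limit from the side into which `ν` points. -/
def opH (κ : ℝ) (q : S2 → E3) (g : E3 → ℂ) (x : E3) : Fin 3 → ℂ :=
  limUnder (𝓝[>] (0 : ℝ)) fun h => tangentialGradAt κ q g h x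

/-- `s₁(x, y) = cos(κ|x-y|) / 2π`. -/
def s1 (κ : ℝ) (x y : E3) : ℂ := (Real.cos (κ * ‖x - y‖) / (2 * Real.pi) : ℝ)

open Classical in
/-- `s₂(x, y) = i sin(κ|x-y|) / (2π|x-y|)` for `x ≠ y`, and `iκ / 2π` for `x = y`. -/
def s2 (κ : ℝ) (x y : E3) : ℂ :=
  if x = y then Complex.I * κ / (2 * Real.pi)
  else Complex.I * (Real.sin (κ * ‖x - y‖) : ℂ) / (2 * Real.pi * ‖x - y‖)

/-- `R(x, y) = |x-y| / |q(x)-q(y)|`. -/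
def ratioR (q : S2 → E3) (x y : S2) : ℝ := ‖(x : E3) - (y : E3)‖ / ‖q x - q y‖

/-- The kernel `R(x, y) s₁(q(x), q(y)) J_q(y)`. -/
def kerS1 (κ : ℝ) (q : S2 → E3) (x y : S2) : ℂ :=
  (ratioR q x y : ℂ) * s1 κ (q x) (q y) * (Jac q y : ℂ)

/-- The kernel `s₂(q(x), q(y)) J_q(y)`. -/
def kerS2 (κ : ℝ) (q : S2 → E3) (x y : S2) : ℂ :=
  s2 κ (q x) (q y) * (Jac q y : ℂ)

/-- The parametrized single-layer operator on `S²`. -/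
def opS (κ : ℝ) (q : S2 → E3) (G : S2 → ℂ) (x : S2) : ℂ :=
  ∫ y, ((1 / ‖(x : E3) - (y : E3)‖ : ℝ) * kerS1 κ q x y + kerS2 κ q x y) * G y ∂sphereMeasure

end

/-! ### Calculus on the sphere through radial extensions. -/

section SphereCalculus

variable {F F' : Type*} [NormedAddCommGroup F] [NormedSpace ℝ F] [NormedAddCommGroup F']
  [NormedSpace ℝ F']

/-! The identity is partial integration on a closed surface. For merely continuous `g` the potential
`V` need not be differentiable up to `Γ`, so the integration is done on the parallel surfaces `q_h =
q + hν`, which avoid `Γ` for small `h ≠ 0`, and then `h → 0+`.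

The differentials of `q` and of `ν` both take values in the plane orthogonal to `ν`, so `q_h` has
normal vector `J_h ν` with the same `ν` (`crossNormal_offsetPoint`). Hence the `j`-th component of
`J_h ν × ∇V(q_h)` is, up to sign, the two-form `d(q_h)_j ∧ d(V ∘ q_h)`. Stokes' theorem `∫ da ∧ db =
0`, applied with a product in place of `b`, moves the derivative from `V ∘ q_h` to the test field
(`integral_offsetJac_mul`). As `h → 0+` the left side converges by the assumed uniform convergence,
the right side because a single-layer potential is continuous across the surface. It remains to see
that `opS` is `2 V ∘ q` and that the matrix product is the two-form `dq_j ∧ dφ_j` summed over `j`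
(`opS_eq_layerPotential`, `conj_matColon_eq`).

Since `q` is only `C²`, `q_h` is only `C¹`, and Stokes' theorem is needed for `C¹` functions, where
`d(a db)` makes no classical sense. `integral_wedge_tderiv` obtains it from an integral over `ℝ³` of
cut-off radial extensions, in which the second derivatives are replaced by difference quotients.

For Hölder continuous `g`, Stokes' theorem also says that `ν(y) × ∇Φ(z - y)` has integral zero over
`Γ` when `z ∉ Γ`. Subtracting `g(x)` times this from the integrand of `ν(x) × ∇V` leaves a kernel of
size `|x - y|^(α - 2)`, uniformly in `h` thanks to `exists_tube_le`. Such integrals are jointly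
continuous in `(h, x)`, including `h = 0` (`continuous_integral_of_weaklySingular`), and compactness
of the sphere turns this into uniform convergence from both sides. -/

theorem S2.norm_coe (x : S2) : ‖(x : E3)‖ = 1 := mem_sphere_zero_iff_norm.mp x.2

theorem S2.coe_ne_zero (x : S2) : (x : E3) ≠ 0 := by
  intro h
  have := S2.norm_coe x
  simp [h] at this

theorem radialExt_of_ne_zero {F : Type*} [Zero F] {f : S2 → F} {w : E3} (hw : w ≠ 0) :
    ∃ x : S2, (x : E3) = ‖w‖⁻¹ • w ∧ radialExt f w = f x := by
  refine ⟨⟨‖w‖⁻¹ • w, ?_⟩, rfl, ?_⟩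
  · rw [mem_sphere_zero_iff_norm, norm_smul, norm_inv, norm_norm,
      inv_mul_cancel₀ (norm_ne_zero_iff.mpr hw)]
  · simp [radialExt, hw]

theorem radialExt_coe {F : Type*} [Zero F] (f : S2 → F) (x : S2) : radialExt f (x : E3) = f x := by
  obtain ⟨y, hy, h⟩ := radialExt_of_ne_zero (f := f) (S2.coe_ne_zero x)
  rw [h]
  congr 1
  ext1
  rw [hy, S2.norm_coe, inv_one, one_smul]

theorem radialExt_smul {F : Type*} [Zero F] (f : S2 → F) {r : ℝ} (hr : 0 < r) (w : E3) :
    radialExt f (r • w) = radialExt f w := by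
  by_cases hw : w = 0
  · simp [hw]
  obtain ⟨y, hy, h⟩ := radialExt_of_ne_zero (f := f) hw
  obtain ⟨y', hy', h'⟩ := radialExt_of_ne_zero (f := f) (smul_ne_zero hr.ne' hw)
  rw [h, h']
  congr 1
  ext1
  rw [hy, hy', norm_smul, Real.norm_of_nonneg hr.le, smul_smul]
  congr 1
  field_simp

/-- `C^n` functions on the sphere, described through their radial extension. -/
def SphereContDiff (n : ℕ∞ω) (f : S2 → F) : Prop := ContDiffOn ℝ n (radialExt f) {0}ᶜ

/-- The derivative of the radial extension at a point of the sphere. -/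
noncomputable def tderiv (f : S2 → F) (x : S2) : E3 →L[ℝ] F := fderiv ℝ (radialExt f) (x : E3)

theorem sphereDeriv_eq_tderiv (f : S2 → F) (x : S2) (v : E3) :
    sphereDeriv f x v = tderiv f x v := rfl

theorem isOpen_compl_zero : IsOpen ({0}ᶜ : Set E3) := isOpen_compl_singleton

/-- Off the origin the radial extension is `f` composed with the smooth retraction `w ↦ w / |w|`
onto the sphere. This is the only passage from manifold smoothness to ordinary calculus. -/
theorem SphereContDiff.of_contMDiff {n : ℕ∞ω} {f : S2 → F} (hf : ContMDiff (𝓡 2) 𝓘(ℝ, F) n f) :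
    SphereContDiff n f := by
  let U : TopologicalSpace.Opens E3 := ⟨{0}ᶜ, isOpen_compl_zero⟩
  let p : U → E3 := fun w => ‖(w : E3)‖⁻¹ • (w : E3)
  have hp0 : ∀ w : U, ContMDiffAt 𝓘(ℝ, E3) 𝓘(ℝ, E3) n p w := by
    intro w
    refine (contMDiffAt_subtype_iff (U := U) (f := fun w : E3 => ‖w‖⁻¹ • w)).2 ?_
    have hw : (w : E3) ≠ 0 := w.2
    exact ((ContDiffAt.inv (contDiffAt_norm ℝ hw) (norm_ne_zero_iff.2 hw)).smul
      contDiffAt_id).contMDiffAt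
  have hp : ∀ w, p w ∈ Metric.sphere (0 : E3) 1 := by
    intro w
    have hw : (w : E3) ≠ 0 := w.2
    rw [mem_sphere_zero_iff_norm, norm_smul, norm_inv, norm_norm,
      inv_mul_cancel₀ (norm_ne_zero_iff.mpr hw)]
  have h1 := ContMDiff.codRestrict_sphere (n := 2) (m := n) (I := 𝓘(ℝ, E3)) (f := p) hp0 hp
  have h2 := hf.comp h1
  intro w hw
  have h3 := h2 ⟨w, hw⟩
  have h4 : f ∘ Set.codRestrict p _ hp = fun w : U => radialExt f (w : E3) := by
    funext w
    have hw : (w : E3) ≠ 0 := w.2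
    simp [radialExt, hw]
    rfl
  rw [h4, contMDiffAt_subtype_iff (U := U) (f := radialExt f)] at h3
  exact h3.contDiffAt.contDiffWithinAt

namespace SphereContDiff

variable {n : ℕ∞ω} {f : S2 → F}

theorem of_le {m : ℕ∞ω} (hf : SphereContDiff n f) (h : m ≤ n) : SphereContDiff m f :=
  ContDiffOn.of_le hf h

theorem contDiffAt (hf : SphereContDiff n f) {w : E3} (hw : w ≠ 0) :
    ContDiffAt ℝ n (radialExt f) w :=
  ContDiffOn.contDiffAt hf (isOpen_compl_zero.mem_nhds hw)

theorem hasFDerivAt (hf : SphereContDiff 1 f) (x : S2) :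
    HasFDerivAt (radialExt f) (tderiv f x) (x : E3) :=
  ((hf.contDiffAt (S2.coe_ne_zero x)).differentiableAt one_ne_zero).hasFDerivAt

theorem continuous (hf : SphereContDiff n f) : Continuous f := by
  have h : f = fun x : S2 => radialExt f (x : E3) := funext fun x => (radialExt_coe f x).symm
  rw [h]
  exact continuous_iff_continuousAt.2 fun x =>
    (hf.contDiffAt (S2.coe_ne_zero x)).continuousAt.comp continuous_subtype_val.continuousAt

theorem continuous_tderiv (hf : SphereContDiff 1 f) : Continuous (tderiv f) :=
  continuous_iff_continuousAt.2 fun x =>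
    (((hf.contDiffAt (S2.coe_ne_zero x)).fderiv_right (m := 0) (by norm_num)).continuousAt).comp
      (f := fun x : S2 => (x : E3)) continuous_subtype_val.continuousAt

/-- The radial extension equals `A (w / |w|)`, so `A` need not be constant along rays, and its
smoothness matters only at points of the sphere. -/
theorem congr_of_ext (A : E3 → F) (hA : ∀ x : S2, ContDiffAt ℝ n A x) (hf : ∀ x : S2, f x = A x) :
    SphereContDiff n f := by
  intro w hw
  have hw : w ≠ 0 := hw
  obtain ⟨y, hy, -⟩ := radialExt_of_ne_zero (f := f) hw
  have h1 : ContDiffAt ℝ n (fun w : E3 => A (‖w‖⁻¹ • w)) w := by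
    refine ContDiffAt.comp (f := fun w : E3 => ‖w‖⁻¹ • w) w (hy ▸ hA y) ?_
    exact ((contDiffAt_norm ℝ hw).inv (norm_ne_zero_iff.2 hw)).smul contDiffAt_id
  refine (h1.congr_of_eventuallyEq ?_).contDiffWithinAt
  filter_upwards [isOpen_compl_zero.mem_nhds hw] with v hv
  obtain ⟨z, hz, h⟩ := radialExt_of_ne_zero (f := f) hv
  rw [h, hf, hz]

theorem comp (hf : SphereContDiff n f) {u : F → F'} (hu : ∀ x, ContDiffAt ℝ n u (f x)) :
    SphereContDiff n (fun x => u (f x)) := by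
  refine congr_of_ext (fun w => u (radialExt f w)) (fun x => ?_) fun x => by rw [radialExt_coe]
  refine ContDiffAt.comp (x : E3) ?_ (hf.contDiffAt (S2.coe_ne_zero x))
  rw [radialExt_coe]
  exact hu x

theorem clm_comp (hf : SphereContDiff n f) (u : F →L[ℝ] F') :
    SphereContDiff n (fun x => u (f x)) :=
  hf.comp fun _ => u.contDiff.contDiffAt

theorem prodMk (hf : SphereContDiff n f) {g : S2 → F'} (hg : SphereContDiff n g) :
    SphereContDiff n (fun x => (f x, g x)) := by
  refine congr_of_ext (fun w => (radialExt f w, radialExt g w)) (fun x => ?_)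
    fun x => by rw [radialExt_coe, radialExt_coe]
  exact (hf.contDiffAt (S2.coe_ne_zero x)).prodMk (hg.contDiffAt (S2.coe_ne_zero x))

theorem add (hf : SphereContDiff n f) {g : S2 → F} (hg : SphereContDiff n g) :
    SphereContDiff n (fun x => f x + g x) :=
  (hf.prodMk hg).comp (u := fun p => p.1 + p.2) fun _ => contDiff_add.contDiffAt

theorem mul {f g : S2 → ℂ} (hf : SphereContDiff n f) (hg : SphereContDiff n g) :
    SphereContDiff n (fun x => f x * g x) :=
  (hf.prodMk hg).comp (u := fun p => p.1 * p.2) fun _ => contDiff_mul.contDiffAt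

end SphereContDiff

theorem radialExt_comp_eventuallyEq {F F' : Type*} [Zero F] [Zero F'] (f : S2 → F)
    (u : F → F') (x : S2) :
    radialExt (fun x => u (f x)) =ᶠ[𝓝 (x : E3)] fun w => u (radialExt f w) := by
  filter_upwards [isOpen_compl_zero.mem_nhds (S2.coe_ne_zero x)] with w hw
  have hw : w ≠ 0 := hw
  simp [radialExt, hw]

theorem tderiv_comp {f : S2 → F} (hf : SphereContDiff 1 f) {u : F → F'} {u' : F →L[ℝ] F'} {x : S2}
    (hu : HasFDerivAt u u' (f x)) : tderiv (fun x => u (f x)) x = u' ∘L tderiv f x := by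
  have h : HasFDerivAt (fun w => u (radialExt f w)) (u' ∘L tderiv f x) (x : E3) :=
    HasFDerivAt.comp (x : E3) (by rwa [radialExt_coe]) (hf.hasFDerivAt x)
  exact (h.congr_of_eventuallyEq (radialExt_comp_eventuallyEq f u x)).fderiv

theorem tderiv_prodMk {f : S2 → F} {g : S2 → F'} (hf : SphereContDiff 1 f)
    (hg : SphereContDiff 1 g) (x : S2) :
    tderiv (fun x => (f x, g x)) x = (tderiv f x).prod (tderiv g x) := by
  refine (((hf.hasFDerivAt x).prodMk (hg.hasFDerivAt x)).congr_of_eventuallyEq ?_).fderiv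
  filter_upwards [isOpen_compl_zero.mem_nhds (S2.coe_ne_zero x)] with w hw
  have hw : w ≠ 0 := hw
  simp [radialExt, hw]

/-- The derivative of a function homogeneous of degree `0` is homogeneous of degree `-1`. -/
theorem fderiv_radialExt_smul (f : S2 → F) {r : ℝ} (hr : 0 < r) (x : S2) :
    fderiv ℝ (radialExt f) (r • (x : E3)) = r⁻¹ • tderiv f x := by
  have h : (fun w => radialExt f (r • w)) = radialExt f := funext fun w => radialExt_smul f hr w
  have h2 := fderiv_comp_smul (𝕜 := ℝ) (f := radialExt f) (x := (x : E3)) r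
  rw [h] at h2
  rw [tderiv, h2, smul_smul, inv_mul_cancel₀ hr.ne', one_smul]

/-- Radial extensions are constant along the ray through `x`. -/
theorem tderiv_self {f : S2 → F} (hf : SphereContDiff 1 f) (x : S2) : tderiv f x x = 0 := by
  have h1 : HasDerivAt (fun r : ℝ => r • (x : E3)) ((1 : ℝ) • (x : E3)) 1 :=
    (hasDerivAt_id 1).smul_const _
  have h0 : HasFDerivAt (radialExt f) (tderiv f x) ((1 : ℝ) • (x : E3)) := by
    rw [one_smul]; exact hf.hasFDerivAt x
  have h2 := h0.comp_hasDerivAt (1 : ℝ) h1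
  have h3 : HasDerivAt (fun _ : ℝ => f x) (tderiv f x ((1 : ℝ) • (x : E3))) 1 := by
    refine h2.congr_of_eventuallyEq ?_
    filter_upwards [lt_mem_nhds (zero_lt_one (α := ℝ))] with r hr
    simp [radialExt_smul f hr, radialExt_coe]
  simpa using h3.unique (hasDerivAt_const _ _)

end SphereCalculus

/-! ### The spherical frame and the two-form `dA ∧ dB`. -/

section Frame

variable {F : Type*} [NormedAddCommGroup F] [NormedSpace ℝ F]

/-- The coordinate expression of `w · (∇A × ∇B)` for linear forms `L = dA`, `M = dB`. -/
noncomputable def wedge (L : E3 →L[ℝ] ℝ) (M : E3 →L[ℝ] F) (w : E3) : F :=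
  w 0 • (L (EuclideanSpace.single 1 1) • M (EuclideanSpace.single 2 1) -
      L (EuclideanSpace.single 2 1) • M (EuclideanSpace.single 1 1)) +
    w 1 • (L (EuclideanSpace.single 2 1) • M (EuclideanSpace.single 0 1) -
      L (EuclideanSpace.single 0 1) • M (EuclideanSpace.single 2 1)) +
    w 2 • (L (EuclideanSpace.single 0 1) • M (EuclideanSpace.single 1 1) -
      L (EuclideanSpace.single 1 1) • M (EuclideanSpace.single 0 1))

theorem E3.eq_sum (v : E3) : v = v 0 • EuclideanSpace.single 0 1 +
    v 1 • EuclideanSpace.single 1 1 + v 2 • EuclideanSpace.single 2 1 := by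
  ext i
  fin_cases i <;> simp

theorem E3.map_eq_sum (M : E3 →L[ℝ] F) (v : E3) : M v = v 0 • M (EuclideanSpace.single 0 1) +
    v 1 • M (EuclideanSpace.single 1 1) + v 2 • M (EuclideanSpace.single 2 1) := by
  conv_lhs => rw [E3.eq_sum v]
  simp only [map_add, map_smul]

@[simp] theorem cross3_zero' (a b : E3) : cross3 a b 0 = a 1 * b 2 - a 2 * b 1 := by
  simp [cross3, crossProduct]

@[simp] theorem cross3_one' (a b : E3) : cross3 a b 1 = a 2 * b 0 - a 0 * b 2 := by
  simp [cross3, crossProduct]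

@[simp] theorem cross3_two' (a b : E3) : cross3 a b 2 = a 0 * b 1 - a 1 * b 0 := by
  simp [cross3, crossProduct]

/-- A two-form on `ℝ³` sees a pair of vectors only through their cross product. With `e_θ × e_φ = x`
this removes the frame, which is discontinuous at the poles, from all later formulas. -/
theorem smul_sub_smul_eq_wedge (L : E3 →L[ℝ] ℝ) (M : E3 →L[ℝ] F) (u v : E3) :
    L u • M v - L v • M u = wedge L M (cross3 u v) := by
  rw [E3.map_eq_sum M v, E3.map_eq_sum M u, E3.map_eq_sum L v, E3.map_eq_sum L u, wedge,
    cross3_zero', cross3_one', cross3_two']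
  simp only [smul_eq_mul]
  module

theorem ePhi_props (x : S2) :
    ePhi x 0 ^ 2 + ePhi x 1 ^ 2 + ePhi x 2 ^ 2 = 1 ∧
      ePhi x 0 * (x : E3) 0 + ePhi x 1 * (x : E3) 1 + ePhi x 2 * (x : E3) 2 = 0 := by
  unfold ePhi
  split_ifs with h
  · simp [h.1, h.2]
  · have h0 : (x : E3) 0 ^ 2 + (x : E3) 1 ^ 2 ≠ 0 := by
      intro h'
      apply h
      constructor <;> nlinarith [sq_nonneg ((x : E3) 0), sq_nonneg ((x : E3) 1)]
    have h1 := Real.sq_sqrt (add_nonneg (sq_nonneg ((x : E3) 0)) (sq_nonneg ((x : E3) 1)))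
    set s := Real.sqrt ((x : E3) 0 ^ 2 + (x : E3) 1 ^ 2)
    have hs : s ≠ 0 := by
      intro h'
      rw [h'] at h1
      exact h0 (by linarith)
    simp
    constructor
    · field_simp
      linarith
    · ring

theorem S2.sq_sum (x : S2) : (x : E3) 0 ^ 2 + (x : E3) 1 ^ 2 + (x : E3) 2 ^ 2 = 1 := by
  have h := S2.norm_coe x
  rw [EuclideanSpace.norm_eq, Real.sqrt_eq_one, Fin.sum_univ_three] at h
  simpa using h

theorem cross3_eTheta_ePhi (x : S2) : cross3 (eTheta x) (ePhi x) = x := by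
  obtain ⟨h1, h2⟩ := ePhi_props x
  have h3 := S2.sq_sum x
  ext i
  fin_cases i <;> simp [eTheta]
  · linear_combination (x : E3) 0 * h1 - ePhi x 0 * h2
  · linear_combination (x : E3) 1 * h1 - ePhi x 1 * h2
  · linear_combination (x : E3) 2 * h1 - ePhi x 2 * h2

theorem cross3_eTheta_coe (x : S2) : cross3 (eTheta x) (x : E3) = - ePhi x := by
  obtain ⟨h1, h2⟩ := ePhi_props x
  have h3 := S2.sq_sum x
  ext i
  fin_cases i <;> simp [eTheta]
  · linear_combination (x : E3) 0 * h2 - ePhi x 0 * h3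
  · linear_combination (x : E3) 1 * h2 - ePhi x 1 * h3
  · linear_combination (x : E3) 2 * h2 - ePhi x 2 * h3

theorem cross3_ePhi_coe (x : S2) : cross3 (ePhi x) (x : E3) = eTheta x := rfl

end Frame

/-! ### Compactly supported extensions from the sphere to space. -/

section Cutoff

/-- A smooth bump function on the line around `1`. -/
noncomputable def lineBump : ContDiffBump (1 : ℝ) := ⟨1 / 4, 1 / 2, by norm_num, by norm_num⟩

/-- A smooth radial function that equals `1` near the unit sphere and vanishes near `0` and `∞`. -/
noncomputable def shellCutoff (w : E3) : ℝ := lineBump (‖w‖ ^ 2)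

theorem contDiff_shellCutoff {n : ℕ∞} : ContDiff ℝ n shellCutoff :=
  (lineBump.contDiff (n := n)).comp (contDiff_norm_sq ℝ)

theorem shellCutoff_eventuallyEq_one (x : S2) : shellCutoff =ᶠ[𝓝 (x : E3)] 1 := by
  have h1 : Tendsto (fun w : E3 => ‖w‖ ^ 2) (𝓝 (x : E3)) (𝓝 1) := by
    have := ((continuous_norm (E := E3)).tendsto (x : E3)).pow 2
    rwa [S2.norm_coe, one_pow] at this
  exact h1.eventually lineBump.eventuallyEq_one

theorem shellCutoff_coe (x : S2) : shellCutoff x = 1 :=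
  (shellCutoff_eventuallyEq_one x).self_of_nhds

theorem shellCutoff_eventuallyEq_zero : shellCutoff =ᶠ[𝓝 (0 : E3)] 0 := by
  filter_upwards [Metric.ball_mem_nhds (0 : E3) (half_pos one_pos)] with w hw
  have hw : ‖w‖ < 1 / 2 := by simpa using hw
  refine lineBump.zero_of_le_dist ?_
  rw [Real.dist_eq, abs_sub_comm]
  refine le_trans ?_ (le_abs_self _)
  change (1 : ℝ) / 2 ≤ _
  nlinarith [norm_nonneg w]

theorem hasCompactSupport_shellCutoff : HasCompactSupport shellCutoff := by
  refine HasCompactSupport.of_support_subset_isCompact (isCompact_closedBall (0 : E3) 2) ?_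
  intro w hw
  rw [mem_closedBall_zero_iff]
  by_contra! h
  refine hw (lineBump.zero_of_le_dist ?_)
  rw [Real.dist_eq]
  refine le_trans ?_ (le_abs_self _)
  change (1 : ℝ) / 2 ≤ _
  nlinarith [norm_nonneg w]

/-- The cutoff is radial, so its gradient at `w` is parallel to `w`; such terms drop out of `wedge`
evaluated at `w`. -/
theorem hasFDerivAt_shellCutoff (w : E3) : ∃ k : ℝ, ∀ i,
    fderiv ℝ shellCutoff w (EuclideanSpace.single i 1) = k * w i := by
  have h1 : DifferentiableAt ℝ lineBump (‖w‖ ^ 2) :=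
    (lineBump.contDiff (n := 1)).differentiable one_ne_zero _
  have h2 := h1.hasDerivAt.comp_hasFDerivAt w (hasStrictFDerivAt_norm_sq w).hasFDerivAt
  refine ⟨deriv lineBump (‖w‖ ^ 2) * 2, fun i => ?_⟩
  have h3 : fderiv ℝ shellCutoff w = _ := h2.fderiv
  have h4 : inner ℝ w (EuclideanSpace.single i (1 : ℝ)) = w i := by
    simp [EuclideanSpace.inner_single_right]
  rw [h3]
  simp only [smul_apply, smul_eq_mul, nsmul_eq_mul, innerSL_apply_apply, h4]
  push_cast
  ring

variable {F : Type*} [NormedAddCommGroup F] [NormedSpace ℝ F]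

/-- A compactly supported extension to `ℝ³` of a function on the sphere. -/
noncomputable def shellExt (f : S2 → F) (w : E3) : F := shellCutoff w • radialExt f w

theorem SphereContDiff.contDiff_shellExt {n : ℕ∞} {f : S2 → F} (hf : SphereContDiff n f) :
    ContDiff ℝ n (shellExt f) := by
  refine contDiff_iff_contDiffAt.2 fun w => ?_
  by_cases hw : w = 0
  · refine (contDiffAt_const (c := (0 : F))).congr_of_eventuallyEq ?_
    filter_upwards [hw ▸ shellCutoff_eventuallyEq_zero] with v hv
    simp [shellExt, hv]
  · exact contDiff_shellCutoff.contDiffAt.smul (hf.contDiffAt hw)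

theorem hasCompactSupport_shellExt (f : S2 → F) : HasCompactSupport (shellExt f) :=
  hasCompactSupport_shellCutoff.smul_right

theorem shellExt_eventuallyEq (f : S2 → F) (x : S2) :
    shellExt f =ᶠ[𝓝 (x : E3)] radialExt f := by
  filter_upwards [shellCutoff_eventuallyEq_one x] with w hw
  simp [shellExt, hw]

theorem shellExt_coe (f : S2 → F) (x : S2) : shellExt f x = f x := by
  rw [(shellExt_eventuallyEq f x).self_of_nhds, radialExt_coe]

theorem fderiv_shellExt (f : S2 → F) (x : S2) : fderiv ℝ (shellExt f) x = tderiv f x :=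
  (shellExt_eventuallyEq f x).fderiv_eq

theorem fderiv_shellExt_apply {f : S2 → F} (hf : SphereContDiff 1 f) {w : E3} (hw : w ≠ 0)
    (v : E3) : fderiv ℝ (shellExt f) w v =
      shellCutoff w • fderiv ℝ (radialExt f) w v + fderiv ℝ shellCutoff w v • radialExt f w := by
  have h : HasFDerivAt (shellExt f) _ w :=
    ((contDiff_shellCutoff (n := 1)).differentiable one_ne_zero w).hasFDerivAt.smul
      ((hf.contDiffAt hw).differentiableAt one_ne_zero).hasFDerivAt
  rw [h.fderiv]
  simp

instance : IsFiniteMeasure sphereMeasure :=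
  inferInstanceAs (IsFiniteMeasure (volume : Measure E3).toSphere)

end Cutoff

/-! ### Stokes' theorem on the sphere for `C¹` functions. -/

section Stokes

/-- For `C²` functions both sides would be `-∫ U ∂_v ∂_w B`. With one derivative only, `∂_v` is
replaced by a difference quotient: integrating by parts in `w` and translating the variable moves
the quotient from `B` to `U`, with `v` replaced by `-v`. Both quotients then converge as the
increment tends to zero. -/
theorem integral_fderiv_mul_fderiv_swap {U B : E3 → ℝ} (hU : ContDiff ℝ 1 U) (hB : ContDiff ℝ 1 B)
    (cU : HasCompactSupport U) (cB : HasCompactSupport B) (v w : E3) :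
    ∫ x, fderiv ℝ U x v * fderiv ℝ B x w = ∫ x, fderiv ℝ U x w * fderiv ℝ B x v := by
  obtain ⟨C, hC⟩ := ContDiff.lipschitzWith_of_hasCompactSupport cU hU one_ne_zero
  obtain ⟨D, hD⟩ := ContDiff.lipschitzWith_of_hasCompactSupport cB hB one_ne_zero
  have dU : ∀ x u, lineDeriv ℝ U x u = fderiv ℝ U x u := fun x u =>
    (hU.differentiable one_ne_zero x).lineDeriv_eq_fderiv
  have dB : ∀ x u, lineDeriv ℝ B x u = fderiv ℝ B x u := fun x u =>
    (hB.differentiable one_ne_zero x).lineDeriv_eq_fderiv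
  have iU : Integrable (fun x => fderiv ℝ U x w) :=
    ((hU.continuous_fderiv one_ne_zero).clm_apply continuous_const).integrable_of_hasCompactSupport
      (cU.fderiv_apply (𝕜 := ℝ) w)
  have iB : Integrable (fun x => fderiv ℝ B x w) :=
    ((hB.continuous_fderiv one_ne_zero).clm_apply continuous_const).integrable_of_hasCompactSupport
      (cB.fderiv_apply (𝕜 := ℝ) w)
  have l1 := hD.integral_inv_smul_sub_mul_tendsto_integral_lineDeriv_mul iU v
  have l2 := hC.integral_inv_smul_sub_mul_tendsto_integral_lineDeriv_mul iB (-v)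
  have key : ∀ t : ℝ, ∫ x, (t⁻¹ • (B (x + t • v) - B x)) * fderiv ℝ U x w =
      - ∫ x, (t⁻¹ • (U (x + t • (-v)) - U x)) * fderiv ℝ B x w := by
    intro t
    have hBt : ContDiff ℝ 1 (fun x => B (x + t • v) - B x) :=
      (hB.comp (contDiff_id.add contDiff_const)).sub hB
    have cBt : HasCompactSupport (fun x => B (x + t • v) - B x) :=
      (cB.comp_homeomorph (Homeomorph.addRight (t • v))).sub cB
    obtain ⟨D', hD'⟩ := ContDiff.lipschitzWith_of_hasCompactSupport cBt hBt one_ne_zero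
    have h1 := LipschitzWith.integral_lineDeriv_mul_eq (μ := (volume : Measure E3)) hC hD' cBt w
    have dBt : ∀ x, lineDeriv ℝ (fun x => B (x + t • v) - B x) x (-w) =
        fderiv ℝ B x w - fderiv ℝ B (x + t • v) w := by
      intro x
      rw [(hBt.differentiable one_ne_zero x).lineDeriv_eq_fderiv,
        fderiv_fun_sub _ (hB.differentiable one_ne_zero x), fderiv_comp_add_right]
      · simp only [sub_apply, map_neg]
        ring
      · exact (hB.comp (contDiff_id.add contDiff_const)).differentiable one_ne_zero x
    simp only [dBt, dU] at h1
    have i1 : Integrable (fun x => U x * fderiv ℝ B x w) :=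
      (hU.continuous.mul ((hB.continuous_fderiv one_ne_zero).clm_apply
        continuous_const)).integrable_of_hasCompactSupport cU.mul_right
    have i2 : Integrable (fun x => U x * fderiv ℝ B (x + t • v) w) :=
      (hU.continuous.mul (((hB.continuous_fderiv one_ne_zero).comp
        (continuous_id.add continuous_const)).clm_apply
        continuous_const)).integrable_of_hasCompactSupport cU.mul_right
    have i3 : Integrable (fun x => U (x + t • (-v)) * fderiv ℝ B x w) := by
      have := i2.comp_add_right (t • (-v))
      simpa using this
    have h3 : ∫ x, U x * fderiv ℝ B (x + t • v) w = ∫ x, U (x + t • (-v)) * fderiv ℝ B x w := by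
      rw [← integral_add_right_eq_self _ (t • (-v))]
      simp
    have h2 : ∫ x, (B (x + t • v) - B x) * fderiv ℝ U x w =
        - ∫ x, (U (x + t • (-v)) - U x) * fderiv ℝ B x w := by
      calc ∫ x, (B (x + t • v) - B x) * fderiv ℝ U x w
          = ∫ x, fderiv ℝ U x w * (B (x + t • v) - B x) := by simp only [mul_comm]
        _ = ∫ x, (U x * fderiv ℝ B x w - U x * fderiv ℝ B (x + t • v) w) := by
            rw [h1]; congr 1; ext x; ring
        _ = _ := by
            rw [integral_sub i1 i2, h3]
            simp only [sub_mul]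
            rw [integral_sub i3 i1]
            ring
    simp only [smul_eq_mul, mul_assoc, integral_const_mul, h2, mul_neg]
  simp only [key] at l1
  have h := tendsto_nhds_unique l1 l2.neg
  simp only [dU, dB, map_neg, neg_mul, integral_neg, neg_neg] at h
  rw [← h]
  simp only [mul_comm]

theorem integral_fderiv_smul_fderiv_swap {U : E3 → ℝ} {B : E3 → ℂ} (hU : ContDiff ℝ 1 U)
    (hB : ContDiff ℝ 1 B) (cU : HasCompactSupport U) (cB : HasCompactSupport B) (v w : E3) :
    ∫ x, fderiv ℝ U x v • fderiv ℝ B x w = ∫ x, fderiv ℝ U x w • fderiv ℝ B x v := by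
  have int : ∀ v w : E3, Integrable fun x => fderiv ℝ U x v • fderiv ℝ B x w := fun v w =>
    (((hU.continuous_fderiv one_ne_zero).clm_apply continuous_const).smul
      ((hB.continuous_fderiv one_ne_zero).clm_apply
        continuous_const)).integrable_of_hasCompactSupport
      (cU.fderiv_apply (𝕜 := ℝ) v).smul_right
  have key : ∀ T : ℂ →L[ℝ] ℝ, T (∫ x, fderiv ℝ U x v • fderiv ℝ B x w) =
      T (∫ x, fderiv ℝ U x w • fderiv ℝ B x v) := by
    intro T
    have hd : ∀ x u, T (fderiv ℝ B x u) = fderiv ℝ (fun y => T (B y)) x u := by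
      intro x u
      have := (T.hasFDerivAt.comp x (hB.differentiable one_ne_zero x).hasFDerivAt).fderiv
      exact (congrArg (fun l : E3 →L[ℝ] ℝ => l u) this).symm
    rw [← T.integral_comp_comm (int v w), ← T.integral_comp_comm (int w v)]
    simp only [map_smul, smul_eq_mul, hd]
    exact integral_fderiv_mul_fderiv_swap hU (T.contDiff.comp hB) cU
      (cB.comp_left (map_zero T)) v w
  exact Complex.ext (key Complex.reCLM) (key Complex.imCLM)

/-- The factor `x i` can be absorbed into `A`: it is constant in the directions `v` and `w`, so the
swap of derivatives applies to `x i * A` and `B`. -/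
theorem integral_coord_smul_fderiv_swap {A : E3 → ℝ} {B : E3 → ℂ} (hA : ContDiff ℝ 1 A)
    (hB : ContDiff ℝ 1 B) (cA : HasCompactSupport A) (cB : HasCompactSupport B) {v w : E3}
    {i : Fin 3} (hv : v i = 0) (hw : w i = 0) :
    Integrable (fun x : E3 => x i • (fderiv ℝ A x v • fderiv ℝ B x w -
      fderiv ℝ A x w • fderiv ℝ B x v)) ∧
    ∫ x : E3, x i • (fderiv ℝ A x v • fderiv ℝ B x w - fderiv ℝ A x w • fderiv ℝ B x v) = 0 := by
  let p : E3 →L[ℝ] ℝ := EuclideanSpace.proj i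
  have hU : ContDiff ℝ 1 (fun x => p x * A x) := p.contDiff.mul hA
  have cU : HasCompactSupport (fun x => p x * A x) := cA.mul_left
  have dU : ∀ x u : E3, u i = 0 → fderiv ℝ (fun x => p x * A x) x u = x i * fderiv ℝ A x u := by
    intro x u hu
    rw [fderiv_fun_mul p.differentiableAt (hA.differentiable one_ne_zero x)]
    simp only [add_apply, smul_apply, p.fderiv, smul_eq_mul]
    have : p u = 0 := hu
    rw [this, mul_zero, add_zero]
    rfl
  have int : ∀ v w : E3, Integrable fun x => x i • (fderiv ℝ A x v • fderiv ℝ B x w) := fun v w =>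
    (p.continuous.smul (((hA.continuous_fderiv one_ne_zero).clm_apply continuous_const).smul
      ((hB.continuous_fderiv one_ne_zero).clm_apply
        continuous_const))).integrable_of_hasCompactSupport
      ((cA.fderiv_apply (𝕜 := ℝ) v).smul_right).smul_left
  have h := integral_fderiv_smul_fderiv_swap hU hB cU cB v w
  simp only [dU _ _ hv, dU _ _ hw, mul_smul] at h
  simp only [smul_sub]
  exact ⟨(int v w).sub (int w v), by rw [integral_sub (int v w) (int w v), h, sub_self]⟩

theorem integral_wedge_fderiv {A : E3 → ℝ} {B : E3 → ℂ} (hA : ContDiff ℝ 1 A)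
    (hB : ContDiff ℝ 1 B) (cA : HasCompactSupport A) (cB : HasCompactSupport B) :
    ∫ x, wedge (fderiv ℝ A x) (fderiv ℝ B x) x = 0 := by
  have h0 := integral_coord_smul_fderiv_swap hA hB cA cB
    (v := EuclideanSpace.single 1 1) (w := EuclideanSpace.single 2 1) (i := 0) (by simp) (by simp)
  have h1 := integral_coord_smul_fderiv_swap hA hB cA cB
    (v := EuclideanSpace.single 2 1) (w := EuclideanSpace.single 0 1) (i := 1) (by simp) (by simp)
  have h2 := integral_coord_smul_fderiv_swap hA hB cA cB
    (v := EuclideanSpace.single 0 1) (w := EuclideanSpace.single 1 1) (i := 2) (by simp) (by simp)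
  unfold wedge
  rw [integral_add (by exact h0.1.add h1.1) h2.1, integral_add h0.1 h1.1, h0.2, h1.2, h2.2]
  simp

/-- Polar coordinates. The weight `r²` sits in `volumeIoiPow 2`, and no integrability is required
because the product formula for integrals holds with the default value `0` as well. -/
theorem integral_eq_sphere_mul_radial {G : E3 → ℂ} {g : S2 → ℂ} {c : ℝ → ℂ}
    (h : ∀ (x : S2) (r : ℝ), 0 < r → G (r • (x : E3)) = g x * c r) :
    ∫ w, G w = (∫ x, g x ∂sphereMeasure) *
      ∫ r : Set.Ioi (0 : ℝ), c r ∂(Measure.volumeIoiPow 2) := by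
  have hm := (volume : Measure E3).measurePreserving_homeomorphUnitSphereProd
  have hd : Module.finrank ℝ E3 - 1 = 2 := by simp
  rw [hd] at hm
  calc ∫ w, G w = ∫ w in ({0}ᶜ : Set E3), G w := by
        rw [restrict_compl_singleton]
    _ = ∫ w : ({0}ᶜ : Set E3), G w ∂((volume : Measure E3).comap (↑)) := by
        rw [integral_subtype_comap (measurableSet_singleton _).compl]
    _ = ∫ w : ({0}ᶜ : Set E3), (fun p : S2 × Set.Ioi (0 : ℝ) => g p.1 * c p.2)
          (homeomorphUnitSphereProd E3 w) ∂((volume : Measure E3).comap (↑)) := by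
        congr 1
        ext w
        have hw : (w : E3) = ((homeomorphUnitSphereProd E3 w).2 : ℝ) •
            ((homeomorphUnitSphereProd E3 w).1 : E3) := by
          conv_lhs => rw [← (homeomorphUnitSphereProd E3).symm_apply_apply w]
          rfl
        conv_lhs => rw [hw]
        exact h _ _ (homeomorphUnitSphereProd E3 w).2.2
    _ = ∫ p : S2 × Set.Ioi (0 : ℝ), g p.1 * c p.2
          ∂(sphereMeasure.prod (Measure.volumeIoiPow 2)) :=
        hm.integral_comp (homeomorphUnitSphereProd E3).measurableEmbedding
          (fun p : S2 × Set.Ioi (0 : ℝ) => g p.1 * c p.2)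
    _ = _ := integral_prod_mul g (fun r : Set.Ioi (0 : ℝ) => c r)

/-- Changing the gradients by multiples of `w` changes their cross product by vectors orthogonal to
`w`. -/
theorem wedge_add_radial {F : Type*} [NormedAddCommGroup F] [NormedSpace ℝ F]
    {L L' : E3 →L[ℝ] ℝ} {M M' : E3 →L[ℝ] F} {w : E3} {z α : ℝ} {β : F}
    (hL : ∀ i, L' (EuclideanSpace.single i 1) = z * L (EuclideanSpace.single i 1) + w i * α)
    (hM : ∀ i, M' (EuclideanSpace.single i 1) = z • M (EuclideanSpace.single i 1) + w i • β) :
    wedge L' M' w = z ^ 2 • wedge L M w := by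
  simp only [wedge, hL, hM]
  module

theorem wedge_smul_smul {F : Type*} [NormedAddCommGroup F] [NormedSpace ℝ F]
    (L : E3 →L[ℝ] ℝ) (M : E3 →L[ℝ] F) (w : E3) (a r : ℝ) :
    wedge (a • L) (a • M) (r • w) = (a ^ 2 * r) • wedge L M w := by
  simp only [wedge, smul_apply, PiLp.smul_apply, smul_eq_mul]
  module

/-- Stokes' theorem on the sphere for the exact two-form `da ∧ db`. -/
theorem integral_wedge_tderiv {a : S2 → ℝ} {b : S2 → ℂ} (ha : SphereContDiff 1 a)
    (hb : SphereContDiff 1 b) :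
    ∫ x, wedge (tderiv a x) (tderiv b x) (x : E3) ∂sphereMeasure = 0 := by
  have hA : ContDiff ℝ 1 (shellExt a) := ha.contDiff_shellExt (n := 1)
  have hB : ContDiff ℝ 1 (shellExt b) := hb.contDiff_shellExt (n := 1)
  have h0 := integral_wedge_fderiv hA hB (hasCompactSupport_shellExt a)
    (hasCompactSupport_shellExt b)
  -- Each derivative contributes a cutoff factor and `r⁻¹`, the position vector contributes `r`.
  let c : ℝ → ℝ := fun r => lineBump (r ^ 2) ^ 2 * r⁻¹
  have hz : ∀ (x : S2) (r : ℝ), 0 < r → shellCutoff (r • (x : E3)) = lineBump (r ^ 2) := by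
    intro x r hr
    simp [shellCutoff, norm_smul]
  have h1 : ∀ (x : S2) (r : ℝ), 0 < r →
      wedge (fderiv ℝ (shellExt a) (r • (x : E3))) (fderiv ℝ (shellExt b) (r • (x : E3)))
        (r • (x : E3)) = wedge (tderiv a x) (tderiv b x) (x : E3) * (c r : ℂ) := by
    intro x r hr
    have hw : r • (x : E3) ≠ 0 := smul_ne_zero hr.ne' (S2.coe_ne_zero x)
    obtain ⟨k, hk⟩ := hasFDerivAt_shellCutoff (r • (x : E3))
    rw [wedge_add_radial (L := r⁻¹ • tderiv a x) (M := r⁻¹ • tderiv b x)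
      (z := lineBump (r ^ 2)) (α := k * a x) (β := k • b x), wedge_smul_smul,
      smul_smul, Complex.real_smul, mul_comm]
    · congr 2
      simp only [c]
      field_simp
    · intro i
      rw [fderiv_shellExt_apply ha hw, hz x r hr, fderiv_radialExt_smul a hr]
      simp [hk, radialExt_smul a hr, radialExt_coe]
      ring
    · intro i
      rw [fderiv_shellExt_apply hb hw, hz x r hr, fderiv_radialExt_smul b hr]
      simp [hk, radialExt_smul b hr, radialExt_coe]
      ring
  rw [integral_eq_sphere_mul_radial h1] at h0
  refine (mul_eq_zero.1 h0).resolve_right fun hc => ?_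
  -- The radial factor is not zero: it also occurs in the polar decomposition of the nonnegative
  -- function `H`, whose integral is positive.
  let H : E3 → ℝ := fun w => shellCutoff w ^ 2 * ‖w‖⁻¹
  have hH : Continuous H := by
    refine continuous_iff_continuousAt.2 fun w => ?_
    by_cases hw : w = 0
    · refine (continuousAt_const (y := (0 : ℝ))).congr ?_
      filter_upwards [hw ▸ shellCutoff_eventuallyEq_zero] with v hv
      simp [H, hv]
    · exact ((contDiff_shellCutoff (n := 1)).continuous.continuousAt.pow 2).mul
        (continuous_norm.continuousAt.inv₀ (norm_ne_zero_iff.2 hw))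
  have cH : HasCompactSupport H := by
    simp only [H, pow_two, mul_assoc]
    exact hasCompactSupport_shellCutoff.mul_right
  have hpos : 0 < ∫ w, H w := by
    refine hH.integral_pos_of_hasCompactSupport_nonneg_nonzero cH
      (fun w => mul_nonneg (sq_nonneg _) (inv_nonneg.2 (norm_nonneg _)))
      (x := ((Classical.arbitrary S2 : S2) : E3)) ?_
    simp [H, shellCutoff_coe]
  have h2 := integral_eq_sphere_mul_radial (G := fun w => (H w : ℂ)) (g := fun _ => 1)
    (c := fun r => (c r : ℂ)) fun x r hr => by
      simp [H, hz x r hr, norm_smul, abs_of_pos hr, c]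
  rw [hc, mul_zero, integral_complex_ofReal, Complex.ofReal_eq_zero] at h2
  exact hpos.ne' h2

end Stokes

/-! ### Weakly singular integrals on the sphere. -/

section WeaklySingular

open Metric Set
open scoped Pointwise

/-- The measure of a cap is three times the volume of the cone over it. For `r ≤ 1` the cone is
covered by about `1 / r` balls of radius `2r` with centres along the axis, of total volume of order
`r²`. -/
theorem exists_sphereMeasure_ball_le : ∃ C : ℝ, 0 ≤ C ∧ ∀ (x : S2) (r : ℝ), 0 < r →
    sphereMeasure (ball x r) ≤ ENNReal.ofReal (C * r ^ 2) := by
  set v : ℝ := (volume (ball (0 : E3) 1)).toReal with hv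
  have hv0 : 0 ≤ v := ENNReal.toReal_nonneg
  have hvol : volume (ball (0 : E3) 1) = ENNReal.ofReal v :=
    (ENNReal.ofReal_toReal measure_ball_lt_top.ne).symm
  have h3 : ((Module.finrank ℝ E3 : ℕ) : ENNReal) = ENNReal.ofReal 3 := by simp
  -- `48 = 3 · 2 · 2³`: the dimension, the bound `2 / r` for the number of balls, and the radius
  -- `2r`.
  refine ⟨48 * v, by positivity, fun x r hr => ?_⟩
  rcases le_or_gt r 1 with hr1 | hr1
  · have hm : sphereMeasure (ball x r) = _ :=
      (volume : Measure E3).toSphere_apply' (measurableSet_ball (x := x) (ε := r))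
    rw [hm, h3]
    set n := ⌈1 / r⌉₊ with hn
    have hn1 : 1 / r ≤ n := Nat.le_ceil _
    have hn2 : (n : ℝ) ≤ 2 / r := by
      have h1 : (n : ℝ) < 1 / r + 1 := Nat.ceil_lt_add_one (by positivity)
      have h2 : 1 ≤ 1 / r := by rw [le_div_iff₀ hr]; linarith
      have h3 : 2 / r = 1 / r + 1 / r := by ring
      linarith
    have hn0 : (0 : ℝ) < n := lt_of_lt_of_le (by positivity) hn1
    have hn3 : 1 / (n : ℝ) ≤ r := by
      rw [div_le_iff₀ hn0]
      rw [div_le_iff₀ hr] at hn1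
      linarith
    have hsub : Ioo (0 : ℝ) 1 • ((↑) '' (ball x r) : Set E3) ⊆
        ⋃ k ∈ Finset.range n, ball (((k : ℝ) / n) • (x : E3)) (2 * r) := by
      rintro _ ⟨t, ht, _, ⟨y, hy, rfl⟩, rfl⟩
      have htn : 0 ≤ t * n := by have := ht.1; positivity
      have hk1 : (⌊t * n⌋₊ : ℝ) ≤ t * n := Nat.floor_le htn
      have hk2 : t * n < ⌊t * n⌋₊ + 1 := Nat.lt_floor_add_one _
      simp only [mem_iUnion, Finset.mem_range]
      refine ⟨⌊t * n⌋₊, ?_, ?_⟩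
      · have : t * n < n := by nlinarith [ht.2]
        exact_mod_cast lt_of_le_of_lt hk1 this
      · have hy' : ‖(y : E3) - x‖ < r := by
          rw [← dist_eq_norm]; exact hy
        rw [mem_ball, dist_eq_norm]
        set k := ⌊t * n⌋₊
        have h1 : t • (y : E3) - ((k : ℝ) / n) • (x : E3) =
            t • ((y : E3) - x) + (t - (k : ℝ) / n) • (x : E3) := by module
        have h2 : ‖t • ((y : E3) - x)‖ ≤ ‖(y : E3) - x‖ := by
          rw [norm_smul, Real.norm_of_nonneg ht.1.le]
          nlinarith [norm_nonneg ((y : E3) - x), ht.2]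
        have h3 : ‖(t - (k : ℝ) / n) • (x : E3)‖ ≤ 1 / n := by
          have h4 : 0 ≤ t - k / n := by
            rw [sub_nonneg, div_le_iff₀ hn0]; exact hk1
          rw [norm_smul, S2.norm_coe, mul_one, Real.norm_of_nonneg h4, sub_le_iff_le_add,
            ← add_div, le_div_iff₀ hn0]
          linarith
        change ‖t • (y : E3) - ((k : ℝ) / n) • (x : E3)‖ < 2 * r
        rw [h1]
        refine (norm_add_le _ _).trans_lt ?_
        linarith
    have hball : ∀ z : E3, volume (ball z (2 * r)) = ENNReal.ofReal ((2 * r) ^ 3 * v) := by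
      intro z
      rw [Measure.addHaar_ball _ _ (by positivity), hvol, ENNReal.ofReal_mul (by positivity)]
      simp
    calc ENNReal.ofReal 3 * volume (Ioo (0 : ℝ) 1 • ((↑) '' (ball x r) : Set E3))
        ≤ ENNReal.ofReal 3 * ∑ k ∈ Finset.range n, ENNReal.ofReal ((2 * r) ^ 3 * v) := by
          gcongr
          refine (measure_mono hsub).trans ((measure_biUnion_finset_le _ _).trans ?_)
          simp only [hball, le_refl]
      _ = ENNReal.ofReal (3 * (n * ((2 * r) ^ 3 * v))) := by
          rw [Finset.sum_const, Finset.card_range, nsmul_eq_mul,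
            ENNReal.ofReal_mul (p := 3) (by norm_num), ENNReal.ofReal_mul hn0.le,
            ENNReal.ofReal_natCast]
      _ ≤ ENNReal.ofReal (48 * v * r ^ 2) := by
          apply ENNReal.ofReal_le_ofReal
          calc 3 * ((n : ℝ) * ((2 * r) ^ 3 * v)) ≤ 3 * (2 / r * ((2 * r) ^ 3 * v)) := by gcongr
            _ = 48 * v * r ^ 2 := by field_simp; ring
  · calc sphereMeasure (ball x r) ≤ sphereMeasure univ := measure_mono (subset_univ _)
      _ = ENNReal.ofReal (3 * v) := by
          have : sphereMeasure univ = _ := (volume : Measure E3).toSphere_apply_univ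
          rw [this, h3, hvol, ENNReal.ofReal_mul (by norm_num)]
      _ ≤ _ := by
          apply ENNReal.ofReal_le_ofReal
          nlinarith [mul_nonneg hv0 (sub_nonneg.2 (one_le_pow₀ hr1.le : 1 ≤ r ^ 2))]

/-- Dyadic decomposition: at distance about `2^(-k)` the integrand is of order `2^(kβ)` and the ball
has measure of order `4^(-k)`. The geometric series has ratio `2^β / 4 < 1`, and its tail is small
independently of the centre. -/
theorem exists_lintegral_ball_rpow_le {β : ℝ} (hβ : 0 < β) (hβ2 : β < 2) {η : ℝ} (hη : 0 < η) :
    ∃ δ > 0, ∀ x : S2,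
      ∫⁻ y in ball x δ, ENNReal.ofReal (dist x y ^ (-β)) ∂sphereMeasure ≤ ENNReal.ofReal η := by
  obtain ⟨C, hC0, hC⟩ := exists_sphereMeasure_ball_le
  set p : ℝ := 2 ^ β / 4 with hp
  have hp0 : 0 < p := by positivity
  have hp1 : p < 1 := by
    have h : (2 : ℝ) ^ β < 2 ^ (2 : ℝ) := Real.rpow_lt_rpow_of_exponent_lt one_lt_two hβ2
    rw [hp, div_lt_one (by norm_num)]
    calc (2 : ℝ) ^ β < 2 ^ (2 : ℝ) := h
      _ = 4 := by norm_num
  set A : ℝ := 4 * 2 ^ β * C with hA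
  have hA0 : 0 ≤ A := by positivity
  have hlim : Tendsto (fun m : ℕ => A * (p ^ m * (1 - p)⁻¹)) atTop (𝓝 0) := by
    simpa using ((tendsto_pow_atTop_nhds_zero_of_lt_one hp0.le hp1).mul_const
      (1 - p)⁻¹).const_mul A
  obtain ⟨m, hm⟩ := (hlim.eventually (gt_mem_nhds hη)).exists
  refine ⟨(1 / 2) ^ m, by positivity, fun x => ?_⟩
  let f : ℕ → S2 → ENNReal := fun k =>
    (ball x (2 * (1 / 2) ^ (m + k))).indicator fun _ => ENNReal.ofReal ((2 ^ (m + k + 1)) ^ β)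
  have hle : ∀ y ∈ ball x ((1 / 2 : ℝ) ^ m),
      ENNReal.ofReal (dist x y ^ (-β)) ≤ ∑' k, f k y := by
    intro y hy
    rcases eq_or_ne x y with rfl | hxy
    -- At the centre the convention `0 ^ (-β) = 0` makes the bound trivial.
    · simp [Real.zero_rpow (neg_ne_zero.2 hβ.ne')]
    have hd : 0 < dist x y := dist_pos.2 hxy
    have hd1 : dist x y < (1 / 2) ^ m := by rw [dist_comm]; exact hy
    obtain ⟨k, hk1, hk2⟩ := exists_nat_pow_near_of_lt_one (y := (1 / 2 : ℝ)) hd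
      (hd1.le.trans (pow_le_one₀ (by norm_num) (by norm_num))) (by norm_num) (by norm_num)
    have hmk : m ≤ k := by
      by_contra! h
      have : (1 / 2 : ℝ) ^ m ≤ (1 / 2) ^ (k + 1) :=
        pow_le_pow_of_le_one (by norm_num) (by norm_num) h
      linarith
    obtain ⟨j, rfl⟩ := Nat.exists_eq_add_of_le hmk
    refine le_trans ?_ (ENNReal.le_tsum j)
    have hmem : y ∈ ball x (2 * (1 / 2 : ℝ) ^ (m + j)) := by
      rw [mem_ball, dist_comm]
      have : (0 : ℝ) < (1 / 2) ^ (m + j) := by positivity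
      linarith
    simp only [f, indicator_of_mem hmem]
    apply ENNReal.ofReal_le_ofReal
    rw [Real.rpow_neg hd.le, ← Real.inv_rpow hd.le]
    refine Real.rpow_le_rpow (by positivity) ?_ hβ.le
    rw [inv_le_comm₀ hd (by positivity)]
    simpa using hk1.le
  calc ∫⁻ y in ball x ((1 / 2) ^ m), ENNReal.ofReal (dist x y ^ (-β)) ∂sphereMeasure
      ≤ ∫⁻ y in ball x ((1 / 2) ^ m), ∑' k, f k y ∂sphereMeasure :=
        setLIntegral_mono' measurableSet_ball hle
    _ ≤ ∫⁻ y, ∑' k, f k y ∂sphereMeasure := setLIntegral_le_lintegral _ _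
    _ = ∑' k, ∫⁻ y, f k y ∂sphereMeasure :=
        lintegral_tsum fun k => (measurable_const.indicator measurableSet_ball).aemeasurable
    _ ≤ ∑' k, ENNReal.ofReal (A * (p ^ m * p ^ k)) := by
        refine ENNReal.tsum_le_tsum fun k => ?_
        rw [lintegral_indicator_const measurableSet_ball]
        refine (mul_le_mul_right (hC x (2 * (1 / 2) ^ (m + k)) (by positivity)) _).trans ?_
        rw [← ENNReal.ofReal_mul (by positivity)]
        apply ENNReal.ofReal_le_ofReal
        apply le_of_eq
        have h1 : ((2 : ℝ) ^ (m + k + 1)) ^ β = 2 ^ β * (2 ^ β) ^ (m + k) := by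
          rw [← Real.rpow_natCast, ← Real.rpow_mul (by norm_num), mul_comm, Real.rpow_mul
            (by norm_num), Real.rpow_natCast, pow_succ, mul_comm]
        have h2 : ((1 / 2 : ℝ) ^ (m + k)) ^ 2 = (1 / 4) ^ (m + k) := by
          rw [← pow_mul, mul_comm, pow_mul]; norm_num
        rw [h1, mul_pow, h2, ← pow_add, hp, hA, div_pow, div_pow, one_pow]
        ring
    _ = ENNReal.ofReal (A * (p ^ m * (1 - p)⁻¹)) := by
        rw [← ENNReal.ofReal_tsum_of_nonneg (fun k => by positivity)]
        · rw [tsum_mul_left, tsum_mul_left, tsum_geometric_of_lt_one hp0.le hp1]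
        · exact ((summable_geometric_of_lt_one hp0.le hp1).mul_left _).mul_left _
    _ ≤ ENNReal.ofReal η := ENNReal.ofReal_le_ofReal hm.le

/-- A continuous cutoff that vanishes on `(-∞, δ / 2]` and equals `1` on `[δ, ∞)`. -/
noncomputable def rampCutoff (δ t : ℝ) : ℝ := min 1 (max 0 (2 * t / δ - 1))

theorem continuous_rampCutoff (δ : ℝ) : Continuous (rampCutoff δ) := by
  unfold rampCutoff
  fun_prop

theorem rampCutoff_mem_Icc (δ t : ℝ) : rampCutoff δ t ∈ Icc (0 : ℝ) 1 :=
  ⟨le_min zero_le_one (le_max_left _ _), min_le_left _ _⟩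

theorem rampCutoff_eq_zero {δ t : ℝ} (hδ : 0 < δ) (h : t ≤ δ / 2) : rampCutoff δ t = 0 := by
  have : 2 * t / δ - 1 ≤ 0 := by
    rw [sub_nonpos, div_le_one hδ]; linarith
  simp [rampCutoff, max_eq_left this]

theorem rampCutoff_eq_one {δ t : ℝ} (hδ : 0 < δ) (h : δ ≤ t) : rampCutoff δ t = 1 := by
  have : 1 ≤ 2 * t / δ - 1 := by
    have : 2 ≤ 2 * t / δ := by rw [le_div_iff₀ hδ]; linarith
    linarith
  exact min_eq_left (this.trans (le_max_right _ _))

variable {F : Type*} [NormedAddCommGroup F] [NormedSpace ℝ F]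

theorem sphereMeasure_singleton (x : S2) : sphereMeasure {x} = 0 := by
  obtain ⟨C, hC0, hC⟩ := exists_sphereMeasure_ball_le
  have h : Tendsto (fun r : ℝ => ENNReal.ofReal (C * r ^ 2)) (𝓝[>] 0) (𝓝 0) := by
    have h1 : Continuous fun r : ℝ => ENNReal.ofReal (C * r ^ 2) :=
      ENNReal.continuous_ofReal.comp (by fun_prop)
    simpa using (h1.tendsto 0).mono_left nhdsWithin_le_nhds
  refine le_antisymm (ge_of_tendsto h ?_) zero_le
  filter_upwards [self_mem_nhdsWithin] with r hr
  exact (measure_mono (singleton_subset_iff.2 (mem_ball_self hr))).trans (hC x r hr)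

instance : NullSingletonClass sphereMeasure := ⟨sphereMeasure_singleton⟩

theorem ContinuousOn.aestronglyMeasurable_sphere {F : Type*} [NormedAddCommGroup F] {f : S2 → F} {x : S2}
    (hf : ContinuousOn f {x}ᶜ) : AEStronglyMeasurable f sphereMeasure := by
  have h := hf.aestronglyMeasurable (μ := sphereMeasure) (measurableSet_singleton x).compl
  rwa [restrict_compl_singleton] at h

theorem integrable_of_weaklySingular {f : S2 → F} {x : S2} {β C : ℝ} (hβ : 0 < β) (hβ2 : β < 2)
    (hf : ∀ y, y ≠ x → ‖f y‖ ≤ C * dist x y ^ (-β)) (hm : ContinuousOn f {x}ᶜ) :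
    Integrable f sphereMeasure := by
  obtain ⟨δ, hδ, h⟩ := exists_lintegral_ball_rpow_le hβ hβ2 one_pos
  have hd : Integrable (fun y => dist x y ^ (-β)) sphereMeasure := by
    have hmeas : Measurable fun y : S2 => dist x y ^ (-β) := by fun_prop
    have h1 : IntegrableOn (fun y => dist x y ^ (-β)) (ball x δ) sphereMeasure := by
      refine ⟨hmeas.aestronglyMeasurable, ?_⟩
      rw [hasFiniteIntegral_iff_ofReal (Eventually.of_forall fun y => by positivity)]
      exact (h x).trans_lt ENNReal.ofReal_lt_top
    have h2 : IntegrableOn (fun y => dist x y ^ (-β)) (ball x δ)ᶜ sphereMeasure := by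
      refine IntegrableOn.of_bound (measure_lt_top _ _) hmeas.aestronglyMeasurable (δ ^ (-β)) ?_
      filter_upwards [ae_restrict_mem measurableSet_ball.compl] with y hy
      rw [Real.norm_of_nonneg (by positivity)]
      refine Real.rpow_le_rpow_of_nonpos hδ ?_ (by linarith)
      rw [dist_comm]
      simpa using hy
    rw [← integrableOn_univ, ← union_compl_self (ball x δ)]
    exact h1.union h2
  refine (hd.const_mul C).mono' hm.aestronglyMeasurable_sphere ?_
  filter_upwards [compl_mem_ae_iff.2 (sphereMeasure_singleton x)] with y hy
  exact hf y hy

/-- Integrals over the sphere with a weakly singular kernel depend continuously on parameters. -/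
theorem continuous_integral_of_weaklySingular {X : Type*} [TopologicalSpace X]
    [FirstCountableTopology X] {π : X → S2} (hπ : Continuous π) {k : X → S2 → F} {β C : ℝ}
    (hβ : 0 < β) (hβ2 : β < 2) (hk : ∀ ξ y, y ≠ π ξ → ‖k ξ y‖ ≤ C * dist (π ξ) y ^ (-β))
    (hm : ∀ ξ, ContinuousOn (k ξ) {π ξ}ᶜ)
    (hc : ∀ ξ y, y ≠ π ξ → ContinuousAt (fun ξ' => k ξ' y) ξ) :
    Continuous fun ξ => ∫ y, k ξ y ∂sphereMeasure := by
  have hk' : ∀ ξ y, y ≠ π ξ → ‖k ξ y‖ ≤ |C| * dist (π ξ) y ^ (-β) := fun ξ y h =>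
    (hk ξ y h).trans (by gcongr; exact le_abs_self C)
  -- The kernel is cut off near its singularity. The truncated integrals are continuous by dominated
  -- convergence, and the error is uniformly small because it only involves a small ball about `π
  -- ξ`.
  refine continuous_of_uniform_approx_of_continuous fun u hu => ?_
  obtain ⟨ε, hε, hu⟩ := Metric.mem_uniformity_dist.1 hu
  obtain ⟨δ, hδ, h⟩ := exists_lintegral_ball_rpow_le hβ hβ2
    (η := ε / (2 * (|C| + 1))) (by positivity)
  let kt : X → S2 → F := fun ξ y => rampCutoff δ (dist (π ξ) y) • k ξ y
  have hkt : ∀ ξ, ContinuousOn (kt ξ) {π ξ}ᶜ := fun ξ =>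
    ((continuous_rampCutoff δ).comp (continuous_const.dist continuous_id)).continuousOn.smul (hm ξ)
  have hkt0 : ∀ ξ y, dist (π ξ) y ≤ δ / 2 → kt ξ y = 0 := fun ξ y hy => by
    simp [kt, rampCutoff_eq_zero hδ hy]
  have hbound : ∀ ξ y, ‖kt ξ y‖ ≤ |C| * (δ / 2) ^ (-β) := by
    intro ξ y
    rcases le_or_gt (dist (π ξ) y) (δ / 2) with hy | hy
    · rw [hkt0 ξ y hy, norm_zero]
      positivity
    · have hne : y ≠ π ξ := by
        rintro rfl
        rw [dist_self] at hy
        linarith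
      have hr := rampCutoff_mem_Icc δ (dist (π ξ) y)
      calc ‖kt ξ y‖ = rampCutoff δ (dist (π ξ) y) * ‖k ξ y‖ := by
            rw [norm_smul, Real.norm_of_nonneg hr.1]
        _ ≤ 1 * ‖k ξ y‖ := by gcongr; exact hr.2
        _ ≤ |C| * dist (π ξ) y ^ (-β) := by rw [one_mul]; exact hk' ξ y hne
        _ ≤ _ := by
            exact mul_le_mul_of_nonneg_left (Real.rpow_le_rpow_of_nonpos (by positivity) hy.le
              (by linarith)) (abs_nonneg C)
  have hcont : ∀ y, Continuous fun ξ => kt ξ y := by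
    intro y
    refine continuous_iff_continuousAt.2 fun ξ => ?_
    rcases eq_or_ne y (π ξ) with hy | hy
    -- If `y` is the singular point for `ξ`, the truncated kernel vanishes for all parameters near
    -- `ξ`.
    · refine (continuousAt_const (y := (0 : F))).congr ?_
      have h1 : ContinuousAt (fun ξ' => dist (π ξ') y) ξ :=
        (hπ.dist continuous_const).continuousAt
      have h2 : ∀ᶠ ξ' in 𝓝 ξ, dist (π ξ') y < δ / 2 :=
        h1.eventually (gt_mem_nhds (by simpa [hy] using hδ))
      filter_upwards [h2] with ξ' hξ'
      exact (hkt0 ξ' y hξ'.le).symm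
    · exact ((continuous_rampCutoff δ).comp (hπ.dist continuous_const)).continuousAt.smul
        (hc ξ y hy)
  refine ⟨fun ξ => ∫ y, kt ξ y ∂sphereMeasure, ?_, fun ξ => hu ?_⟩
  · exact continuous_of_dominated (fun ξ => (hkt ξ).aestronglyMeasurable_sphere)
      (fun ξ => Eventually.of_forall (hbound ξ)) (integrable_const _)
      (Eventually.of_forall hcont)
  · have i1 : Integrable (k ξ) sphereMeasure :=
      integrable_of_weaklySingular hβ hβ2 (hk ξ) (hm ξ)
    have i2 : Integrable (kt ξ) sphereMeasure :=
      Integrable.of_bound (hkt ξ).aestronglyMeasurable_sphere _ (Eventually.of_forall (hbound ξ))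
    rw [dist_eq_norm, ← integral_sub i1 i2]
    have h1 : ‖∫ y, (k ξ y - kt ξ y) ∂sphereMeasure‖ₑ ≤
        ENNReal.ofReal (|C| * (ε / (2 * (|C| + 1)))) := by
      calc ‖∫ y, (k ξ y - kt ξ y) ∂sphereMeasure‖ₑ
          ≤ ∫⁻ y, ‖k ξ y - kt ξ y‖ₑ ∂sphereMeasure := enorm_integral_le_lintegral_enorm _
        _ ≤ ∫⁻ y, (ball (π ξ) δ).indicator
              (fun y => ENNReal.ofReal |C| * ENNReal.ofReal (dist (π ξ) y ^ (-β))) y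
              ∂sphereMeasure := by
            refine lintegral_mono_ae ?_
            filter_upwards [compl_mem_ae_iff.2 (sphereMeasure_singleton (π ξ))] with y hy
            by_cases hyb : y ∈ ball (π ξ) δ
            · rw [indicator_of_mem hyb, ← ENNReal.ofReal_mul (abs_nonneg _), ← ofReal_norm]
              apply ENNReal.ofReal_le_ofReal
              refine le_trans ?_ (hk' ξ y hy)
              have hr := rampCutoff_mem_Icc δ (dist (π ξ) y)
              have h2 : k ξ y - kt ξ y = (1 - rampCutoff δ (dist (π ξ) y)) • k ξ y := by
                simp only [kt]; module
              rw [h2, norm_smul, Real.norm_of_nonneg (by linarith [hr.2])]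
              nlinarith [norm_nonneg (k ξ y), hr.1]
            · have h3 : δ ≤ dist (π ξ) y := by
                rw [dist_comm]; simpa using hyb
              simp [kt, rampCutoff_eq_one hδ h3]
        _ = ENNReal.ofReal |C| *
              ∫⁻ y in ball (π ξ) δ, ENNReal.ofReal (dist (π ξ) y ^ (-β)) ∂sphereMeasure := by
            rw [lintegral_indicator measurableSet_ball, lintegral_const_mul]
            fun_prop
        _ ≤ ENNReal.ofReal |C| * ENNReal.ofReal (ε / (2 * (|C| + 1))) := by gcongr; exact h _
        _ = _ := (ENNReal.ofReal_mul (abs_nonneg _)).symm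
    rw [← ofReal_norm, ENNReal.ofReal_le_ofReal_iff (by positivity)] at h1
    refine h1.trans_lt ?_
    rw [mul_div_assoc', div_lt_iff₀ (by positivity)]
    nlinarith [abs_nonneg C, mul_nonneg hε.le (abs_nonneg C)]

end WeaklySingular

/-! ### Geometry of the parametrized surface: normal, chords, tube. -/

section SurfaceGeometry

/-- The `j`-th component of a linear map into `ℝ³`. -/
noncomputable def compL (L : E3 →L[ℝ] E3) (j : Fin 3) : E3 →L[ℝ] ℝ :=
  (EuclideanSpace.proj j : E3 →L[ℝ] ℝ) ∘L L

@[simp] theorem compL_apply (L : E3 →L[ℝ] E3) (j : Fin 3) (v : E3) : compL L j v = L v j := rfl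

/-- The action of the cofactor matrix of `L` on a vector. -/
noncomputable def cofactorMap (L : E3 →L[ℝ] E3) (w : E3) : E3 :=
  !₂[wedge (compL L 1) (compL L 2) w, wedge (compL L 2) (compL L 0) w,
    wedge (compL L 0) (compL L 1) w]

theorem cross3_map_map (L : E3 →L[ℝ] E3) (u v : E3) :
    cross3 (L u) (L v) = cofactorMap L (cross3 u v) := by
  simp only [cofactorMap, ← smul_sub_smul_eq_wedge, compL_apply, smul_eq_mul]
  ext i
  fin_cases i <;> simp <;> ring

theorem contDiff_cofactorMap {n : ℕ∞ω} :
    ContDiff ℝ n fun p : (E3 →L[ℝ] E3) × E3 => cofactorMap p.1 p.2 := by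
  have h : ∀ (i : Fin 3) (v : E3), ContDiff ℝ n fun p : (E3 →L[ℝ] E3) × E3 => p.1 v i :=
    fun i v => (EuclideanSpace.proj i : E3 →L[ℝ] ℝ).contDiff.comp
      (contDiff_fst.clm_apply contDiff_const)
  have h' : ∀ (i : Fin 3), ContDiff ℝ n fun p : (E3 →L[ℝ] E3) × E3 => p.2 i :=
    fun i => (EuclideanSpace.proj i : E3 →L[ℝ] ℝ).contDiff.comp contDiff_snd
  refine contDiff_euclidean.2 fun i => ?_
  fin_cases i <;> simp only [cofactorMap, wedge, compL_apply] <;>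
  exact (((h' 0).smul (((h _ _).smul (h _ _)).sub ((h _ _).smul (h _ _)))).add
    ((h' 1).smul (((h _ _).smul (h _ _)).sub ((h _ _).smul (h _ _))))).add
    ((h' 2).smul (((h _ _).smul (h _ _)).sub ((h _ _).smul (h _ _))))

theorem frame_expansion (x : S2) (w : E3) :
    ∃ α β γ : ℝ, w = α • eTheta x + β • ePhi x + γ • (x : E3) ∧
      γ = inner ℝ (x : E3) w := by
  have h3 := S2.sq_sum x
  have hx := cross3_eTheta_ePhi x
  have h0 := congrArg (fun v : E3 => v 0) hx
  have h1 := congrArg (fun v : E3 => v 1) hx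
  have h2 := congrArg (fun v : E3 => v 2) hx
  simp only [cross3_zero', cross3_one', cross3_two'] at h0 h1 h2
  set u := eTheta x
  set v := ePhi x
  set a := cross3 w (x : E3) with ha
  have a0 := cross3_zero' w (x : E3)
  have a1 := cross3_one' w (x : E3)
  have a2 := cross3_two' w (x : E3)
  rw [← ha] at a0 a1 a2
  -- The tangential part of `w` is `x × (w × x)`; with `x = u × v` and `a = w × x` the double cross
  -- product is `(u · a) v - (v · a) u`.
  refine ⟨-(v 0 * a 0 + v 1 * a 1 + v 2 * a 2), u 0 * a 0 + u 1 * a 1 + u 2 * a 2, _, ?_, rfl⟩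
  have hin : inner ℝ (x : E3) w = w 0 * (x : E3) 0 + w 1 * (x : E3) 1 + w 2 * (x : E3) 2 := by
    simp [PiLp.inner_apply, Fin.sum_univ_three]
  rw [hin]
  ext i
  fin_cases i <;> simp
  · linear_combination (-a 2) * h1 + a 1 * h2 - w 0 * h3 + (x : E3) 2 * a1 - (x : E3) 1 * a2
  · linear_combination (-a 0) * h2 + a 2 * h0 - w 1 * h3 + (x : E3) 0 * a2 - (x : E3) 2 * a0
  · linear_combination (-a 1) * h0 + a 0 * h1 - w 2 * h3 + (x : E3) 1 * a0 - (x : E3) 0 * a1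

theorem cross3_smul_add_smul (a b : E3) (α β : ℝ) :
    cross3 (α • a + β • b) b = α • cross3 a b ∧ cross3 a (α • a + β • b) = β • cross3 a b := by
  constructor <;> ext i <;> fin_cases i <;> simp <;> ring

theorem inner_cross3_left (a b : E3) : inner ℝ (cross3 a b) a = 0 := by
  simp [PiLp.inner_apply, Fin.sum_univ_three]; ring

theorem inner_cross3_right (a b : E3) : inner ℝ (cross3 a b) b = 0 := by
  simp [PiLp.inner_apply, Fin.sum_univ_three]; ring

/-- The unnormalized normal vector `t₁ × t₂`. -/
noncomputable def crossNormal (q : S2 → E3) (x : S2) : E3 := cross3 (t1 q x) (t2 q x)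

/-- Free of the frame, `t₁ × t₂` is visibly a smooth function of the derivative of `q` and of `x`,
at the poles too. -/
theorem crossNormal_eq (q : S2 → E3) (x : S2) :
    crossNormal q x = cofactorMap (tderiv q x) x := by
  rw [crossNormal, t1, t2, sphereDeriv_eq_tderiv, sphereDeriv_eq_tderiv, cross3_map_map,
    cross3_eTheta_ePhi]

theorem inner_crossNormal_tderiv {q : S2 → E3} (hq : SphereContDiff 1 q) (x : S2) (v : E3) :
    inner ℝ (crossNormal q x) (tderiv q x v) = 0 := by
  obtain ⟨α, β, γ, hv, -⟩ := frame_expansion x v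
  have h1 : tderiv q x (eTheta x) = t1 q x := rfl
  have h2 : tderiv q x (ePhi x) = t2 q x := rfl
  rw [hv, map_add, map_add, map_smul, map_smul, map_smul, tderiv_self hq, h1, h2, crossNormal,
    inner_add_right, inner_add_right, inner_smul_right, inner_smul_right, inner_cross3_left,
    inner_cross3_right]
  simp

variable {q : S2 → E3}

/-- A nonzero Jacobian makes `q` an immersion: taking cross products of `α t₁ + β t₂ = 0` with `t₂`
and `t₁` gives `α = β = 0`. -/
theorem tderiv_eq_zero (hq : SphereContDiff 1 q) {x : S2} (hx : Jac q x ≠ 0) {v : E3}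
    (hv : tderiv q x v = 0) (hxv : inner ℝ (x : E3) v = 0) : v = 0 := by
  obtain ⟨α, β, γ, h, hγ⟩ := frame_expansion x v
  have h1 : tderiv q x (eTheta x) = t1 q x := rfl
  have h2 : tderiv q x (ePhi x) = t2 q x := rfl
  rw [hxv] at hγ
  have h0 : α • t1 q x + β • t2 q x = 0 := by
    rw [← hv, h, map_add, map_add, map_smul, map_smul, map_smul, tderiv_self hq, h1, h2, smul_zero,
      add_zero]
  have hc := cross3_smul_add_smul (t1 q x) (t2 q x) α β
  have z1 : ∀ b, cross3 0 b = 0 := fun b => by ext i; fin_cases i <;> simp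
  have z2 : ∀ b, cross3 b 0 = 0 := fun b => by ext i; fin_cases i <;> simp
  have hn : cross3 (t1 q x) (t2 q x) ≠ 0 := norm_ne_zero_iff.1 hx
  rw [h0, z1, z2] at hc
  have hα := (smul_eq_zero.1 hc.1.symm).resolve_right hn
  have hβ := (smul_eq_zero.1 hc.2.symm).resolve_right hn
  rw [h, hα, hβ, hγ]
  simp

theorem crossNormal_sphereContDiff (hq : SphereContDiff 2 q) :
    SphereContDiff 1 (crossNormal q) := by
  refine SphereContDiff.congr_of_ext (fun w => cofactorMap (fderiv ℝ (radialExt q) w) w)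
    (fun x => ?_) (crossNormal_eq q)
  have h : ContDiffAt ℝ 1 (fderiv ℝ (radialExt q)) (x : E3) :=
    (hq.contDiffAt (S2.coe_ne_zero x)).fderiv_right (by norm_num)
  exact contDiff_cofactorMap.contDiffAt.comp (x : E3) (h.prodMk contDiffAt_id)

theorem normalQ_eq (q : S2 → E3) (x : S2) : normalQ q x = ‖crossNormal q x‖⁻¹ • crossNormal q x :=
  rfl

theorem normalQ_sphereContDiff (hq : SphereContDiff 2 q) (hJ : ∀ x, Jac q x ≠ 0) :
    SphereContDiff 1 (normalQ q) := by
  refine (crossNormal_sphereContDiff hq).comp (u := fun v => ‖v‖⁻¹ • v) fun x => ?_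
  have hn : crossNormal q x ≠ 0 := norm_ne_zero_iff.1 (hJ x)
  exact ((contDiffAt_norm ℝ hn).inv (norm_ne_zero_iff.2 hn)).smul contDiffAt_id

theorem continuous_Jac (hq : SphereContDiff 2 q) : Continuous (Jac q) :=
  (crossNormal_sphereContDiff hq).continuous.norm

theorem Jac_smul_normalQ {x : S2} (hJ : Jac q x ≠ 0) :
    Jac q x • normalQ q x = crossNormal q x := by
  rw [normalQ, smul_smul, mul_inv_cancel₀ hJ, one_smul, crossNormal]

theorem norm_normalQ {x : S2} (hJ : Jac q x ≠ 0) : ‖normalQ q x‖ = 1 := by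
  rw [normalQ, norm_smul, norm_inv, Jac, norm_norm]
  exact inv_mul_cancel₀ hJ

theorem inner_normalQ_tderiv (hq : SphereContDiff 1 q) (x : S2) (v : E3) :
    inner ℝ (normalQ q x) (tderiv q x v) = 0 := by
  rw [normalQ_eq, inner_smul_left, inner_crossNormal_tderiv hq, mul_zero]

/-- Differentiation of `|ν|² = 1`. -/
theorem inner_normalQ_tderiv_normalQ (hq : SphereContDiff 2 q) (hJ : ∀ x, Jac q x ≠ 0) (x : S2)
    (v : E3) : inner ℝ (normalQ q x) (tderiv (normalQ q) x v) = 0 := by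
  have h1 := (normalQ_sphereContDiff hq hJ).hasFDerivAt x
  have h2 := h1.norm_sq
  have h3 : HasFDerivAt (fun w => ‖radialExt (normalQ q) w‖ ^ 2) (0 : E3 →L[ℝ] ℝ) (x : E3) := by
    refine (hasFDerivAt_const (1 : ℝ) _).congr_of_eventuallyEq ?_
    filter_upwards [isOpen_compl_zero.mem_nhds (S2.coe_ne_zero x)] with w hw
    obtain ⟨y, -, hy⟩ := radialExt_of_ne_zero (f := normalQ q) hw
    rw [hy, norm_normalQ (hJ y), one_pow]
  have h4 := congrArg (fun l : E3 →L[ℝ] ℝ => l v) (h2.unique h3)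
  simpa [radialExt_coe] using h4

theorem S2.dist_eq (x y : S2) : dist x y = ‖(x : E3) - y‖ := by
  rw [Subtype.dist_eq, dist_eq_norm]

/-- By compactness of `S2 × S2` a local bound suffices. Off the diagonal it comes from injectivity,
near the diagonal from the immersion property. -/
theorem exists_chord_le (hq : SphereContDiff 1 q) (hinj : Function.Injective q)
    (hJ : ∀ x, Jac q x ≠ 0) : ∃ c > 0, ∀ x y : S2, c * dist x y ≤ ‖q x - q y‖ := by
  have key : ∃ c > 0, ∀ p ∈ (Set.univ : Set (S2 × S2)),
      c * dist p.1 p.2 ≤ ‖q p.1 - q p.2‖ := by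
    refine isCompact_univ.induction_on
      (p := fun s : Set (S2 × S2) => ∃ c > 0, ∀ p ∈ s, c * dist p.1 p.2 ≤ ‖q p.1 - q p.2‖)
      ⟨1, one_pos, by simp⟩ ?_ ?_ ?_
    · rintro s t hst ⟨c, hc, h⟩
      exact ⟨c, hc, fun p hp => h p (hst hp)⟩
    · rintro s t ⟨c, hc, h⟩ ⟨c', hc', h'⟩
      refine ⟨min c c', lt_min hc hc', fun p hp => ?_⟩
      rcases hp with hp | hp
      · exact (mul_le_mul_of_nonneg_right (min_le_left _ _) dist_nonneg).trans (h p hp)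
      · exact (mul_le_mul_of_nonneg_right (min_le_right _ _) dist_nonneg).trans (h' p hp)
    · rintro ⟨x, y⟩ -
      rw [nhdsWithin_univ]
      rcases eq_or_ne x y with rfl | hxy
      -- The radial extension of `q` has the radial direction in the kernel of its derivative.
      -- Adjoining `|w|²` makes the derivative injective and adds nothing to differences between
      -- points of the sphere.
      · let f : E3 → E3 × ℝ := fun w => (radialExt q w, ‖w‖ ^ 2)
        let f' : E3 →L[ℝ] E3 × ℝ := (tderiv q x).prod (2 • innerSL ℝ (x : E3))
        have hf : HasStrictFDerivAt f f' (x : E3) :=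
          ((hq.contDiffAt (S2.coe_ne_zero x)).hasStrictFDerivAt one_ne_zero).prodMk
            (hasStrictFDerivAt_norm_sq (x : E3))
        have hker : LinearMap.ker (f' : E3 →ₗ[ℝ] E3 × ℝ) = ⊥ := by
          refine LinearMap.ker_eq_bot'.2 fun v hv => ?_
          have hv : (tderiv q x v, (2 • innerSL ℝ (x : E3)) v) = (0 : E3 × ℝ) := hv
          rw [Prod.mk_eq_zero] at hv
          exact tderiv_eq_zero hq (hJ x) hv.1 (by simpa using hv.2)
        obtain ⟨K, hK, hanti⟩ := LinearMap.exists_antilipschitzWith (f' : E3 →ₗ[ℝ] E3 × ℝ) hker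
        have hK' : (0 : ℝ) < K := hK
        obtain ⟨s, hs, happ⟩ := hf.approximates_deriv_on_nhds (c := (2 * K)⁻¹)
          (Or.inr (by positivity))
        refine ⟨(fun p : S2 × S2 => ((p.1 : E3), (p.2 : E3))) ⁻¹' (s ×ˢ s), ?_, (2 * (K : ℝ))⁻¹,
          by positivity, ?_⟩
        · exact ((continuous_subtype_val.comp continuous_fst).prodMk
            (continuous_subtype_val.comp continuous_snd)).continuousAt.preimage_mem_nhds
            (prod_mem_nhds hs hs)
        · rintro ⟨y, z⟩ ⟨hy, hz⟩
          have h1 := happ y hy z hz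
          have h2 := hanti.le_mul_dist ((y : E3) - z) 0
          rw [map_zero, dist_zero_right, dist_zero_right] at h2
          have h2 : ‖(y : E3) - z‖ ≤ K * ‖f' ((y : E3) - z)‖ := h2
          have h3 : f y - f z = (q y - q z, 0) := by
            simp [f, radialExt_coe]
          have h4 : ‖f y - f z‖ = ‖q y - q z‖ := by
            rw [h3, Prod.norm_def]; simp
          have h5 : ‖f' ((y : E3) - z)‖ ≤ ‖q y - q z‖ + (2 * (K : ℝ))⁻¹ * ‖(y : E3) - z‖ := by
            rw [← h4]
            have h6 : f' ((y : E3) - z) = (f y - f z) - (f y - f z - f' ((y : E3) - z)) := by abel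
            rw [h6]
            refine (norm_sub_le _ _).trans (by gcongr; simpa using h1)
          have h7 : ‖(y : E3) - z‖ ≤ K * (‖q y - q z‖ + (2 * (K : ℝ))⁻¹ * ‖(y : E3) - z‖) :=
            h2.trans (by gcongr)
          change (2 * (K : ℝ))⁻¹ * dist y z ≤ ‖q y - q z‖
          rw [S2.dist_eq, inv_mul_le_iff₀ (by positivity)]
          have h8 : K * ((2 * (K : ℝ))⁻¹ * ‖(y : E3) - z‖) = ‖(y : E3) - z‖ / 2 := by
            field_simp
          rw [mul_add, h8] at h7
          linarith
      · have hq0 : 0 < ‖q x - q y‖ := norm_pos_iff.2 (sub_ne_zero.2 (hinj.ne hxy))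
        have hc1 : Continuous fun p : S2 × S2 => ‖q p.1 - q p.2‖ :=
          ((hq.continuous.comp continuous_fst).sub (hq.continuous.comp continuous_snd)).norm
        refine ⟨{p | ‖q x - q y‖ / 2 < ‖q p.1 - q p.2‖},
          hc1.continuousAt.eventually (lt_mem_nhds (half_lt_self hq0)), ‖q x - q y‖ / 4,
          by positivity, fun p hp => ?_⟩
        have hp : ‖q x - q y‖ / 2 < ‖q p.1 - q p.2‖ := hp
        have hd : dist p.1 p.2 ≤ 2 := by
          rw [S2.dist_eq]
          refine (norm_sub_le _ _).trans ?_
          rw [S2.norm_coe, S2.norm_coe]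
          norm_num
        nlinarith
  obtain ⟨c, hc, h⟩ := key
  exact ⟨c, hc, fun x y => h (x, y) trivial⟩

theorem SphereContDiff.exists_lipschitz {F : Type*} [NormedAddCommGroup F] [NormedSpace ℝ F]
    {f : S2 → F} (hf : SphereContDiff 1 f) :
    ∃ K : ℝ, 0 ≤ K ∧ ∀ x y, ‖f x - f y‖ ≤ K * dist x y := by
  obtain ⟨K, hK⟩ := ContDiff.lipschitzWith_of_hasCompactSupport (hasCompactSupport_shellExt f)
    (hf.contDiff_shellExt (n := 1)) one_ne_zero
  refine ⟨K, K.2, fun x y => ?_⟩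
  have := hK.dist_le_mul (x : E3) (y : E3)
  rwa [shellExt_coe, shellExt_coe, dist_eq_norm] at this

/-- The normal annihilates the first-order term of the Taylor expansion of `q` at `x`; the remainder
is quadratic because the derivative of the extension is Lipschitz. -/
theorem exists_inner_normalQ_le (hq : SphereContDiff 2 q) (hJ : ∀ x, Jac q x ≠ 0) :
    ∃ M : ℝ, 0 ≤ M ∧ ∀ x y : S2, |inner ℝ (normalQ q x) (q x - q y)| ≤ M * dist x y ^ 2 := by
  have hq1 : SphereContDiff 1 q := hq.of_le (by norm_num)
  have hQ : ContDiff ℝ 2 (shellExt q) := hq.contDiff_shellExt (n := 2)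
  obtain ⟨K, hK⟩ := ContDiff.lipschitzWith_of_hasCompactSupport
    ((hasCompactSupport_shellExt q).fderiv (𝕜 := ℝ)) (hQ.fderiv_right (m := 1) (by norm_num))
    one_ne_zero
  refine ⟨K, K.2, fun x y => ?_⟩
  have h1 : ‖shellExt q y - shellExt q x - fderiv ℝ (shellExt q) x ((y : E3) - x)‖ ≤
      (K * dist x y) * ‖(y : E3) - x‖ := by
    refine (convex_closedBall (x : E3) (dist x y)).norm_image_sub_le_of_norm_hasFDerivWithin_le'
      (f' := fderiv ℝ (shellExt q)) (fun z _ => ((hQ.differentiable (by norm_num)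
        z).hasFDerivAt).hasFDerivWithinAt) (fun z hz => ?_) ?_ ?_
    · rw [← dist_eq_norm]
      exact (hK.dist_le_mul z x).trans (mul_le_mul_of_nonneg_left hz K.2)
    · exact Metric.mem_closedBall_self dist_nonneg
    · rw [Metric.mem_closedBall, ← Subtype.dist_eq, dist_comm]
  rw [shellExt_coe, shellExt_coe, fderiv_shellExt, norm_sub_rev (y : E3), ← S2.dist_eq] at h1
  have h2 : inner ℝ (normalQ q x) (q x - q y) =
      - inner ℝ (normalQ q x) (q y - q x - tderiv q x ((y : E3) - x)) := by
    rw [inner_sub_right _ (q y - q x), inner_normalQ_tderiv hq1, sub_zero, ← inner_neg_right,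
      neg_sub]
  rw [h2, abs_neg]
  refine (abs_real_inner_le_norm _ _).trans ?_
  rw [norm_normalQ (hJ x), one_mul]
  linarith

/-- In `|q x - q y + h ν|² = |q x - q y|² + 2h ν · (q x - q y) + h²` the mixed term is at most `2
|h| M d²`, where `d` is the distance of `x` and `y`, and is absorbed by the chord term for small
`h`. The first bound controls kernels uniformly in `h`, the second keeps the parallel surface off
`Γ`. -/
theorem exists_tube_le (hq : SphereContDiff 2 q) (hinj : Function.Injective q)
    (hJ : ∀ x, Jac q x ≠ 0) : ∃ h₀ > 0, ∃ c > 0, ∀ (x y : S2) (h : ℝ), |h| ≤ h₀ →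
      c * dist x y ≤ ‖q x + h • normalQ q x - q y‖ ∧ |h| ≤ ‖q x + h • normalQ q x - q y‖ := by
  obtain ⟨c, hc, hcq⟩ := exists_chord_le (hq.of_le (by norm_num)) hinj hJ
  obtain ⟨M, hM, hMq⟩ := exists_inner_normalQ_le hq hJ
  -- With this `h₀` the mixed term is at most `c² d² / 2`, half of the lower bound for the chord
  -- term.
  refine ⟨c ^ 2 / (4 * (M + 1)), by positivity, c / 2, by positivity, fun x y h hh => ?_⟩
  have h1 : ‖q x + h • normalQ q x - q y‖ ^ 2 =
      ‖q x - q y‖ ^ 2 + 2 * h * inner ℝ (normalQ q x) (q x - q y) + h ^ 2 := by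
    have : q x + h • normalQ q x - q y = (q x - q y) + h • normalQ q x := by abel
    rw [this, norm_add_sq_real, norm_smul, norm_normalQ (hJ x), inner_smul_right,
      real_inner_comm, Real.norm_eq_abs, mul_one, sq_abs]
    ring
  have h2 := hMq x y
  have h3 := hcq x y
  set d := dist x y
  set i := inner ℝ (normalQ q x) (q x - q y)
  have hd : 0 ≤ d := dist_nonneg
  have h4 : |h| * (4 * (M + 1)) ≤ c ^ 2 := by rwa [le_div_iff₀ (by positivity)] at hh
  have h5 : |2 * h * i| ≤ c ^ 2 / 2 * d ^ 2 := by
    rw [abs_mul, abs_mul, abs_two]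
    calc 2 * |h| * |i| ≤ 2 * |h| * (M * d ^ 2) := by gcongr
      _ ≤ c ^ 2 / 2 * d ^ 2 := by 
          nlinarith [mul_nonneg (abs_nonneg h) (sq_nonneg d),
            mul_le_mul_of_nonneg_right h4 (sq_nonneg d)]
  have h6 : (c * d) ^ 2 ≤ ‖q x - q y‖ ^ 2 := by gcongr
  have h7 := neg_abs_le (2 * h * i)
  have h8 : (c / 2 * d) ^ 2 ≤ ‖q x + h • normalQ q x - q y‖ ^ 2 := by
    rw [h1]
    nlinarith [sq_nonneg h, sq_nonneg (c * d)]
  have h9 : |h| ^ 2 ≤ ‖q x + h • normalQ q x - q y‖ ^ 2 := by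
    rw [h1, sq_abs]
    nlinarith [sq_nonneg (c * d)]
  exact ⟨le_of_sq_le_sq h8 (norm_nonneg _), le_of_sq_le_sq h9 (norm_nonneg _)⟩

end SurfaceGeometry

/-! ### The fundamental solution and the single-layer potential off the surface. -/

section Potential

/-- The fundamental solution of the Helmholtz equation with pole at the origin. -/
noncomputable def helmholtz (κ : ℝ) (w : E3) : ℂ :=
  (1 / (4 * Real.pi) : ℂ) * (Complex.exp (Complex.I * κ * ‖w‖) / ‖w‖)

theorem Phi_eq_helmholtz (κ : ℝ) (x y : E3) : Phi κ x y = helmholtz κ (x - y) := rfl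

/-- The radial profile of the fundamental solution. -/
noncomputable def helmholtzProfile (κ : ℝ) (r : ℝ) : ℂ :=
  (1 / (4 * Real.pi) : ℂ) * (Complex.exp (Complex.I * κ * r) / r)

theorem norm_exp_I_mul_mul (κ r : ℝ) : ‖Complex.exp (Complex.I * κ * r)‖ = 1 := by
  have := Complex.norm_exp_I_mul_ofReal (κ * r)
  rwa [Complex.ofReal_mul, ← mul_assoc] at this

theorem norm_four_pi_inv_le : ‖(1 / (4 * Real.pi) : ℂ)‖ ≤ 1 := by
  rw [norm_div, norm_one, norm_mul, Complex.norm_real, Real.norm_of_nonneg Real.pi_pos.le]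
  rw [div_le_one (by norm_num; exact Real.pi_pos)]
  norm_num
  linarith [Real.pi_gt_three]

theorem norm_helmholtz_le (κ : ℝ) (w : E3) : ‖helmholtz κ w‖ ≤ ‖w‖⁻¹ := by
  rw [helmholtz, norm_mul, norm_div (Complex.exp _), norm_exp_I_mul_mul, Complex.norm_real,
    norm_norm, one_div ‖w‖]
  exact mul_le_of_le_one_left (by positivity) norm_four_pi_inv_le

theorem contDiffAt_helmholtz (κ : ℝ) {n : ℕ∞ω} {w : E3} (hw : w ≠ 0) :
    ContDiffAt ℝ n (helmholtz κ) w := by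
  have h1 : ContDiffAt ℝ n (fun w : E3 => (‖w‖ : ℂ)) w :=
    Complex.ofRealCLM.contDiff.contDiffAt.comp w (contDiffAt_norm ℝ hw)
  have h2 : (‖w‖ : ℂ) ≠ 0 := by simpa using hw
  exact contDiffAt_const.mul ((contDiffAt_const.mul h1).cexp.mul (h1.inv h2))

theorem continuousAt_fderiv_helmholtz (κ : ℝ) {w : E3} (hw : w ≠ 0) :
    ContinuousAt (fderiv ℝ (helmholtz κ)) w :=
  ((contDiffAt_helmholtz κ (n := 1) hw).fderiv_right (m := 0) (by norm_num)).continuousAt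

theorem hasFDerivAt_helmholtz (κ : ℝ) {w : E3} (hw : w ≠ 0) :
    HasFDerivAt (helmholtz κ) (fderiv ℝ (helmholtz κ) w) w :=
  ((contDiffAt_helmholtz κ (n := 1) hw).differentiableAt one_ne_zero).hasFDerivAt

theorem norm_fderiv_helmholtz_le (κ : ℝ) {w : E3} (hw : w ≠ 0) :
    ‖fderiv ℝ (helmholtz κ) w‖ ≤ (‖w‖ ^ 2)⁻¹ + |κ| * ‖w‖⁻¹ := by
  set r := ‖w‖ with hr
  have hr0 : 0 < r := norm_pos_iff.2 hw
  have hrc : (r : ℂ) ≠ 0 := by exact_mod_cast hr0.ne'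
  have h1 : HasDerivAt (helmholtzProfile κ) ((1 / (4 * Real.pi) : ℂ) *
      ((Complex.exp (Complex.I * κ * r) * (Complex.I * κ * 1) * r -
        Complex.exp (Complex.I * κ * r) * 1) / (r : ℂ) ^ 2)) r := by
    have h2 : HasDerivAt (fun s : ℝ => (s : ℂ)) 1 r := Complex.ofRealCLM.hasDerivAt
    exact ((h2.const_mul (Complex.I * κ)).cexp.div h2 hrc).const_mul _
  have h3 : HasFDerivAt (fun w : E3 => ‖w‖) (fderiv ℝ (fun w : E3 => ‖w‖) w) w :=
    ((contDiffAt_norm ℝ hw (n := 1)).differentiableAt one_ne_zero).hasFDerivAt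
  have h4 : HasFDerivAt (helmholtzProfile κ ∘ fun w : E3 => ‖w‖) _ w := h1.hasFDerivAt.comp w h3
  have h5 : ‖fderiv ℝ (fun w : E3 => ‖w‖) w‖ ≤ 1 := by
    have := norm_fderiv_le_of_lipschitz ℝ (lipschitzWith_one_norm (E := E3)) (x₀ := w)
    simpa using this
  have h6 : helmholtz κ = helmholtzProfile κ ∘ fun w : E3 => ‖w‖ := rfl
  rw [h6, h4.fderiv]
  refine (ContinuousLinearMap.opNorm_comp_le _ _).trans ?_
  refine (mul_le_of_le_one_right (norm_nonneg _) h5).trans ?_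
  rw [ContinuousLinearMap.norm_toSpanSingleton]
  rw [norm_mul, norm_div _ ((r : ℂ) ^ 2), norm_pow, Complex.norm_real,
    Real.norm_of_nonneg hr0.le]
  refine (mul_le_of_le_one_left (by positivity) norm_four_pi_inv_le).trans ?_
  rw [div_le_iff₀ (by positivity)]
  refine (norm_sub_le _ _).trans ?_
  rw [mul_one, norm_mul, norm_mul, norm_mul, mul_one, norm_exp_I_mul_mul, Complex.norm_I,
    Complex.norm_real, Complex.norm_real, Real.norm_eq_abs, Real.norm_of_nonneg hr0.le]
  apply le_of_eq
  field_simp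
  ring

/-- The density of a layer potential, transplanted to the sphere. -/
noncomputable def layerDensity (q : S2 → E3) (g : E3 → ℂ) (y : S2) : ℂ := (Jac q y : ℂ) * g (q y)

variable {q : S2 → E3} {g : E3 → ℂ}

theorem continuous_layerDensity (hq : SphereContDiff 2 q) (hg : ContinuousOn g (Set.range q)) :
    Continuous (layerDensity q g) :=
  (Complex.continuous_ofReal.comp (continuous_Jac hq)).mul
    (hg.comp_continuous hq.continuous fun y => ⟨y, rfl⟩)

theorem layerPotential_eq (κ : ℝ) (hq : SphereContDiff 2 q) (hinj : Function.Injective q)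
    (g : E3 → ℂ) (z : E3) : layerPotential κ q g z =
      ∫ y, helmholtz κ (z - q y) * layerDensity q g y ∂sphereMeasure := by
  have hemb : MeasurableEmbedding q := (hq.continuous.isClosedEmbedding hinj).measurableEmbedding
  rw [layerPotential, surfaceMeasure, hemb.integral_map,
    integral_withDensity_eq_integral_toReal_smul
      (continuous_Jac hq).measurable.ennreal_ofReal
      (Eventually.of_forall fun _ => ENNReal.ofReal_lt_top)]
  congr 1
  ext y
  rw [ENNReal.toReal_ofReal (show 0 ≤ Jac q y from norm_nonneg _), Phi_eq_helmholtz,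
    layerDensity, Complex.real_smul]
  ring

/-- The derivative of the layer potential off the surface. -/
noncomputable def layerGrad (κ : ℝ) (q : S2 → E3) (g : E3 → ℂ) (z : E3) : E3 →L[ℝ] ℂ :=
  ∫ y, layerDensity q g y • fderiv ℝ (helmholtz κ) (z - q y) ∂sphereMeasure

theorem isOpen_compl_range (hq : Continuous q) : IsOpen (Set.range q)ᶜ :=
  (isCompact_range hq).isClosed.isOpen_compl

theorem exists_ball_dist_le (hq : Continuous q) {z : E3} (hz : z ∉ Set.range q) :
    ∃ ε > 0, ∀ z' ∈ Metric.ball z ε, ∀ y, ε ≤ ‖z' - q y‖ := by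
  obtain ⟨ε, hε, h⟩ := Metric.mem_nhds_iff.1 ((isOpen_compl_range hq).mem_nhds hz)
  refine ⟨ε / 2, by positivity, fun z' hz' y => ?_⟩
  by_contra! h1
  refine h (a := q y) ?_ ⟨y, rfl⟩
  rw [Metric.mem_ball] at hz' ⊢
  rw [← dist_eq_norm] at h1
  have := dist_triangle_left (q y) z z'
  linarith

theorem continuous_helmholtz_sub (κ : ℝ) (hq : Continuous q) {z : E3} (hz : z ∉ Set.range q) :
    Continuous fun y => helmholtz κ (z - q y) :=
  continuous_iff_continuousAt.2 fun y => ContinuousAt.comp (g := helmholtz κ)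
    (contDiffAt_helmholtz κ (n := 0) (sub_ne_zero.2 fun h => hz ⟨y, h.symm⟩)).continuousAt
    (continuous_const.sub hq).continuousAt

theorem continuous_fderiv_helmholtz_sub (κ : ℝ) (hq : Continuous q) {z : E3}
    (hz : z ∉ Set.range q) : Continuous fun y => fderiv ℝ (helmholtz κ) (z - q y) :=
  continuous_iff_continuousAt.2 fun y => ContinuousAt.comp (g := fderiv ℝ (helmholtz κ))
    (continuousAt_fderiv_helmholtz κ (sub_ne_zero.2 fun h => hz ⟨y, h.symm⟩))
    (continuous_const.sub hq).continuousAt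

theorem Continuous.integrable_sphere {F : Type*} [NormedAddCommGroup F] {f : S2 → F}
    (hf : Continuous f) : Integrable f sphereMeasure :=
  hf.integrable_of_hasCompactSupport (HasCompactSupport.of_compactSpace f)

theorem norm_smul_fderiv_helmholtz_le (κ : ℝ) {ε : ℝ} (hε : 0 < ε) {w : E3} (hw : ε ≤ ‖w‖)
    (a : ℂ) : ‖a • fderiv ℝ (helmholtz κ) w‖ ≤ ‖a‖ * ((ε ^ 2)⁻¹ + |κ| * ε⁻¹) := by
  rw [norm_smul]
  gcongr
  refine (norm_fderiv_helmholtz_le κ (norm_pos_iff.1 (hε.trans_le hw))).trans ?_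
  gcongr

theorem hasFDerivAt_layerPotential (κ : ℝ) (hq : SphereContDiff 2 q) (hinj : Function.Injective q)
    (hg : ContinuousOn g (Set.range q)) {z : E3} (hz : z ∉ Set.range q) :
    HasFDerivAt (layerPotential κ q g) (layerGrad κ q g z) z := by
  have hqc := hq.continuous
  have hμ := continuous_layerDensity hq hg
  obtain ⟨ε, hε, hball⟩ := exists_ball_dist_le hqc hz
  have hV : layerPotential κ q g = fun z =>
      ∫ y, helmholtz κ (z - q y) * layerDensity q g y ∂sphereMeasure :=
    funext (layerPotential_eq κ hq hinj g)
  rw [hV]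
  refine hasFDerivAt_integral_of_dominated_of_fderiv_le (s := Metric.ball z ε)
    (F' := fun z y => layerDensity q g y • fderiv ℝ (helmholtz κ) (z - q y))
    (bound := fun y => ‖layerDensity q g y‖ * ((ε ^ 2)⁻¹ + |κ| * ε⁻¹))
    (Metric.ball_mem_nhds z hε) ?_ ?_ ?_ ?_ ?_ ?_
  · filter_upwards [(isOpen_compl_range hqc).mem_nhds hz] with z' hz'
    exact ((continuous_helmholtz_sub κ hqc hz').mul hμ).aestronglyMeasurable
  · exact ((continuous_helmholtz_sub κ hqc hz).mul hμ).integrable_sphere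
  · exact (hμ.smul (continuous_fderiv_helmholtz_sub κ hqc hz)).aestronglyMeasurable
  · exact Eventually.of_forall fun y z' hz' =>
      norm_smul_fderiv_helmholtz_le κ hε (hball z' hz' y) _
  · exact (hμ.norm.mul continuous_const).integrable_sphere
  · refine Eventually.of_forall fun y z' hz' => ?_
    have hne : z' - q y ≠ 0 := norm_pos_iff.1 (hε.trans_le (hball z' hz' y))
    have h1 : HasFDerivAt (fun z => helmholtz κ (z - q y)) (fderiv ℝ (helmholtz κ) (z' - q y)) z' := by
      simpa using! (hasFDerivAt_helmholtz κ hne).comp z' ((hasFDerivAt_id z').sub_const (q y))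
    exact h1.mul_const (layerDensity q g y)

theorem continuousAt_layerGrad (κ : ℝ) (hq : SphereContDiff 2 q)
    (hg : ContinuousOn g (Set.range q)) {z : E3} (hz : z ∉ Set.range q) :
    ContinuousAt (layerGrad κ q g) z := by
  have hqc := hq.continuous
  have hμ := continuous_layerDensity hq hg
  obtain ⟨ε, hε, hball⟩ := exists_ball_dist_le hqc hz
  refine continuousAt_of_dominated
    (bound := fun y => ‖layerDensity q g y‖ * ((ε ^ 2)⁻¹ + |κ| * ε⁻¹)) ?_ ?_ ?_ ?_
  · filter_upwards [(isOpen_compl_range hqc).mem_nhds hz] with z' hz'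
    exact (hμ.smul (continuous_fderiv_helmholtz_sub κ hqc hz')).aestronglyMeasurable
  · filter_upwards [Metric.ball_mem_nhds z hε] with z' hz'
    exact Eventually.of_forall fun y => norm_smul_fderiv_helmholtz_le κ hε (hball z' hz' y) _
  · exact (hμ.norm.mul continuous_const).integrable_sphere
  · refine Eventually.of_forall fun y => ?_
    have h : ContinuousAt (fun x => fderiv ℝ (helmholtz κ) (x - q y)) z := ContinuousAt.comp (g := fderiv ℝ (helmholtz κ)) (continuousAt_fderiv_helmholtz κ
      (sub_ne_zero.2 fun h => hz ⟨y, h.symm⟩)) (continuousAt_id.sub continuousAt_const)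
    exact h.const_smul (layerDensity q g y)

theorem contDiffAt_layerPotential (κ : ℝ) (hq : SphereContDiff 2 q) (hinj : Function.Injective q)
    (hg : ContinuousOn g (Set.range q)) {z : E3} (hz : z ∉ Set.range q) :
    ContDiffAt ℝ 1 (layerPotential κ q g) z :=
  contDiffAt_one_iff.2 ⟨layerGrad κ q g, _, (isOpen_compl_range hq.continuous).mem_nhds hz,
    fun _ hw => (continuousAt_layerGrad κ hq hg hw).continuousWithinAt,
    fun _ hw => hasFDerivAt_layerPotential κ hq hinj hg hw⟩

end Potential

/-! ### The tangential gradient and Stokes' theorem on a parametrized surface. -/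

section CrossGrad

/-- The bilinear map `(n, L) ↦ n × ∇`, where `L` is the derivative and `∇` the gradient. -/
noncomputable def crossGrad : E3 →L[ℝ] (E3 →L[ℝ] ℂ) →L[ℝ] (Fin 3 → ℂ) :=
  (LinearMap.mk₂ ℝ (fun (n : E3) (L : E3 →L[ℝ] ℂ) =>
    crossProduct (toC3 n) (fun i => L (EuclideanSpace.single i 1)))
    (fun a b L => by
      have : toC3 (a + b) = toC3 a + toC3 b := by ext i; simp [toC3]
      rw [this, map_add, LinearMap.add_apply])
    (fun c a L => by
      have : toC3 (c • a) = (c : ℂ) • toC3 a := by ext i; simp [toC3]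
      rw [this, map_smul, LinearMap.smul_apply]
      ext i
      simp)
    (fun a L M => by
      have : (fun i => (L + M) (EuclideanSpace.single i 1)) =
        (fun i => L (EuclideanSpace.single i 1)) + fun i => M (EuclideanSpace.single i 1) := rfl
      rw [this, map_add])
    (fun c a L => by
      have : (fun i => (c • L) (EuclideanSpace.single i 1)) =
        (c : ℂ) • fun i => L (EuclideanSpace.single i 1) := by ext i; simp
      rw [this, map_smul]
      ext i
      simp)).toContinuousBilinearMap

theorem crossGrad_apply (n : E3) (L : E3 →L[ℝ] ℂ) :
    crossGrad n L = crossProduct (toC3 n) (fun i => L (EuclideanSpace.single i 1)) := rfl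

/-- The rule `(a × b) × c = b (a · c) - a (b · c)`: only derivatives along `a` and `b` enter. -/
theorem crossGrad_cross3 (a b : E3) (M : E3 →L[ℝ] ℂ) (j : Fin 3) :
    crossGrad (cross3 a b) M j = b j • M a - a j • M b := by
  rw [crossGrad_apply, E3.map_eq_sum M a, E3.map_eq_sum M b]
  simp only [Complex.real_smul]
  fin_cases j <;> simp [crossProduct, toC3] <;> ring

/-- The cross product of the normal of a parametrized surface with a gradient, in terms of
derivatives on the parameter sphere. -/
theorem crossGrad_crossNormal {p : S2 → E3} (hp : SphereContDiff 1 p) {f : E3 → ℂ}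
    {M : E3 →L[ℝ] ℂ} {x : S2} (hf : HasFDerivAt f M (p x)) (j : Fin 3) :
    crossGrad (crossNormal p x) M j =
      - wedge (tderiv (fun y => p y j) x) (tderiv (fun y => f (p y)) x) (x : E3) := by
  have h1 : tderiv (fun y => p y j) x = compL (tderiv p x) j :=
    tderiv_comp hp (EuclideanSpace.proj j : E3 →L[ℝ] ℝ).hasFDerivAt
  rw [h1, tderiv_comp hp hf, ← cross3_eTheta_ePhi, ← smul_sub_smul_eq_wedge, neg_sub]
  exact crossGrad_cross3 _ _ _ _

/-- Stokes' theorem on a closed surface: the integral of `ν × ∇f` vanishes. -/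
theorem integral_crossGrad_crossNormal {p : S2 → E3} (hp : SphereContDiff 2 p) {f : E3 → ℂ}
    (hf : ∀ x, ContDiffAt ℝ 1 f (p x)) :
    ∫ x, crossGrad (crossNormal p x) (fderiv ℝ f (p x)) ∂sphereMeasure = 0 := by
  have hp1 : SphereContDiff 1 p := hp.of_le (by norm_num)
  have hc : Continuous fun x => crossGrad (crossNormal p x) (fderiv ℝ f (p x)) := by
    have h1 : Continuous fun x => fderiv ℝ f (p x) := continuous_iff_continuousAt.2 fun x =>
      ContinuousAt.comp (g := fderiv ℝ f) ((hf x).fderiv_right (m := 0) (by norm_num)).continuousAt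
        hp1.continuous.continuousAt
    exact (crossGrad.continuous.comp (crossNormal_sphereContDiff hp).continuous).clm_apply h1
  ext j
  rw [eval_integral (f := fun x => crossGrad (crossNormal p x) (fderiv ℝ f (p x)))
    fun i => ((continuous_apply i).comp hc).integrable_sphere]
  have h : ∀ x, crossGrad (crossNormal p x) (fderiv ℝ f (p x)) j =
      - wedge (tderiv (fun y => p y j) x) (tderiv (fun y => f (p y)) x) (x : E3) := fun x =>
    crossGrad_crossNormal hp1 ((hf x).differentiableAt one_ne_zero).hasFDerivAt j
  simp only [h]
  have hpj : SphereContDiff 1 fun y => p y j :=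
    hp1.clm_comp (EuclideanSpace.proj j : E3 →L[ℝ] ℝ)
  rw [integral_neg, integral_wedge_tderiv hpj (hp1.comp hf), neg_zero]
  rfl

end CrossGrad

/-! ### Uniform boundary limits for Hölder continuous densities. -/

section BoundaryLimit

variable {q : S2 → E3} {g : E3 → ℂ}

theorem crossGrad_smul_right (n : E3) (a : ℂ) (L : E3 →L[ℝ] ℂ) :
    crossGrad n (a • L) = a • crossGrad n L := by
  have : (fun i => (a • L) (EuclideanSpace.single i 1)) =
    a • fun i => L (EuclideanSpace.single i 1) := rfl
  rw [crossGrad_apply, this, map_smul, crossGrad_apply]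

theorem norm_crossGrad_le (n : E3) (L : E3 →L[ℝ] ℂ) : ‖crossGrad n L‖ ≤ 2 * ‖n‖ * ‖L‖ := by
  have h1 : ∀ i j : Fin 3, ‖(n i : ℂ) * L (EuclideanSpace.single j 1)‖ ≤ ‖n‖ * ‖L‖ := by
    intro i j
    rw [norm_mul, Complex.norm_real]
    refine mul_le_mul (PiLp.norm_apply_le n i) ?_ (norm_nonneg _) (norm_nonneg _)
    simpa using L.le_opNorm (EuclideanSpace.single j 1)
  have h2 : ∀ i j k l : Fin 3, ‖(n i : ℂ) * L (EuclideanSpace.single j 1) -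
      (n k : ℂ) * L (EuclideanSpace.single l 1)‖ ≤ 2 * ‖n‖ * ‖L‖ := fun i j k l =>
    (norm_sub_le _ _).trans (by linarith [h1 i j, h1 k l])
  refine (pi_norm_le_iff_of_nonneg (by positivity)).2 fun i => ?_
  rw [crossGrad_apply]
  fin_cases i <;> simpa [crossProduct, toC3] using h2 _ _ _ _

theorem normal_apply (hinj : Function.Injective q) (x : S2) : normal q (q x) = normalQ q x := by
  rw [normal, Function.leftInverse_invFun hinj x]

theorem tangentialGradAt_eq (κ : ℝ) (hinj : Function.Injective q) (h : ℝ) (x : S2) :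
    tangentialGradAt κ q g h (q x) = (2 : ℂ) • crossGrad (normalQ q x)
      (fderiv ℝ (layerPotential κ q g) (q x + h • normalQ q x)) := by
  rw [tangentialGradAt, normal_apply hinj]
  rfl

/-- The kernel of the tangential gradient of the layer potential, regularized by means of Stokes'
theorem. -/
noncomputable def tangentialKernel (κ : ℝ) (q : S2 → E3) (g : E3 → ℂ) (z : E3) (x y : S2) :
    Fin 3 → ℂ :=
  (Jac q y : ℂ) • (g (q y) • crossGrad (normalQ q x) (fderiv ℝ (helmholtz κ) (z - q y)) -
    g (q x) • crossGrad (normalQ q y) (fderiv ℝ (helmholtz κ) (z - q y)))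

/-- Stokes' theorem for `w ↦ helmholtz κ (z - w)`, which is smooth along the surface; the reflection
in `w` only changes the sign. -/
theorem integral_Jac_smul_crossGrad_eq_zero (κ : ℝ) (hq : SphereContDiff 2 q)
    (hJ : ∀ x, Jac q x ≠ 0) {z : E3} (hz : z ∉ Set.range q) :
    ∫ y, (Jac q y : ℂ) • crossGrad (normalQ q y) (fderiv ℝ (helmholtz κ) (z - q y))
      ∂sphereMeasure = 0 := by
  have hne : ∀ y, z - q y ≠ 0 := fun y => sub_ne_zero.2 fun h => hz ⟨y, h.symm⟩
  have h1 := integral_crossGrad_crossNormal hq (f := fun w => helmholtz κ (z - w)) fun x =>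
    (contDiffAt_helmholtz κ (hne x)).comp (q x) (contDiffAt_const.sub contDiffAt_id)
  rw [← neg_eq_zero, ← integral_neg, ← h1]
  congr 1
  ext1 y
  have h2 : fderiv ℝ (fun w => helmholtz κ (z - w)) (q y) =
      - fderiv ℝ (helmholtz κ) (z - q y) := by
    have h3 : HasFDerivAt (fun w : E3 => z - w) (-(ContinuousLinearMap.id ℝ E3)) (q y) :=
      (hasFDerivAt_id (q y)).const_sub z
    have h4 := ((hasFDerivAt_helmholtz κ (hne y)).comp (q y) h3).fderiv
    have h5 : fderiv ℝ (fun w => helmholtz κ (z - w)) (q y) = _ := h4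
    rw [h5]
    ext v
    simp
  rw [h2, ← Jac_smul_normalQ (hJ y), map_neg, map_smul]
  rfl

/-- The term with `g (q x)` in the kernel integrates to zero, so it may be inserted at no cost off
the surface. -/
theorem crossGrad_layerGrad (κ : ℝ) (hq : SphereContDiff 2 q) (hJ : ∀ x, Jac q x ≠ 0)
    (hg : ContinuousOn g (Set.range q)) {z : E3} (hz : z ∉ Set.range q) (x : S2) :
    crossGrad (normalQ q x) (layerGrad κ q g z) =
      ∫ y, tangentialKernel κ q g z x y ∂sphereMeasure := by
  have hD := continuous_fderiv_helmholtz_sub κ hq.continuous hz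
  have hμ := continuous_layerDensity hq hg
  have hN := (normalQ_sphereContDiff hq hJ).continuous
  have hJc : Continuous fun y => (Jac q y : ℂ) :=
    Complex.continuous_ofReal.comp (continuous_Jac hq)
  rw [layerGrad, ← ContinuousLinearMap.integral_comp_comm _ (hμ.fun_smul hD).integrable_sphere]
  have h1 : Continuous fun y => layerDensity q g y •
      crossGrad (normalQ q x) (fderiv ℝ (helmholtz κ) (z - q y)) :=
    hμ.smul ((crossGrad (normalQ q x)).continuous.comp hD)
  have h2 : Continuous fun y => (Jac q y : ℂ) •
      crossGrad (normalQ q y) (fderiv ℝ (helmholtz κ) (z - q y)) :=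
    hJc.smul ((crossGrad.continuous.comp hN).clm_apply hD)
  have h3 : ∀ y, tangentialKernel κ q g z x y =
      layerDensity q g y • crossGrad (normalQ q x) (fderiv ℝ (helmholtz κ) (z - q y)) -
      g (q x) • ((Jac q y : ℂ) •
        crossGrad (normalQ q y) (fderiv ℝ (helmholtz κ) (z - q y))) := by
    intro y
    rw [tangentialKernel, layerDensity, smul_sub, smul_smul, smul_comm (g (q x))]
  simp only [h3, crossGrad_smul_right]
  rw [integral_sub h1.integrable_sphere (h2.fun_const_smul (g (q x))).integrable_sphere,
    integral_smul, integral_Jac_smul_crossGrad_eq_zero κ hq hJ hz, smul_zero, sub_zero]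

theorem S2.dist_le_two (x y : S2) : dist x y ≤ 2 := by
  rw [S2.dist_eq]
  refine (norm_sub_le _ _).trans ?_
  rw [S2.norm_coe, S2.norm_coe]
  norm_num

theorem exists_norm_le_of_continuous {F : Type*} [NormedAddCommGroup F] {f : S2 → F}
    (hf : Continuous f) : ∃ B, 0 ≤ B ∧ ∀ x, ‖f x‖ ≤ B := by
  obtain ⟨B, hB⟩ := (isCompact_range hf).isBounded.exists_norm_le
  exact ⟨B, (norm_nonneg _).trans (hB _ ⟨Classical.arbitrary S2, rfl⟩), fun x => hB _ ⟨x, rfl⟩⟩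

theorem norm_fderiv_helmholtz_le_of_chord (κ : ℝ) {c : ℝ} (hc : 0 < c) {x y : S2} (hxy : y ≠ x)
    {w : E3} (hw : c * dist x y ≤ ‖w‖) : ‖fderiv ℝ (helmholtz κ) w‖ ≤
      ((c ^ 2)⁻¹ + |κ| * (2 * c⁻¹)) * dist x y ^ (-2 : ℝ) := by
  have hd : 0 < dist x y := dist_pos.2 hxy.symm
  have hw0 : w ≠ 0 := norm_pos_iff.1 (lt_of_lt_of_le (by positivity) hw)
  calc ‖fderiv ℝ (helmholtz κ) w‖ ≤ (‖w‖ ^ 2)⁻¹ + |κ| * ‖w‖⁻¹ := norm_fderiv_helmholtz_le κ hw0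
    _ ≤ ((c * dist x y) ^ 2)⁻¹ + |κ| * (c * dist x y)⁻¹ := by gcongr
    _ ≤ ((c ^ 2)⁻¹ + |κ| * (2 * c⁻¹)) * (dist x y ^ 2)⁻¹ := by
        rw [mul_pow, mul_inv, mul_inv, add_mul]
        have h1 : (dist x y)⁻¹ ≤ 2 * (dist x y ^ 2)⁻¹ := by
          rw [← div_eq_mul_inv, le_div_iff₀ (by positivity), pow_two, ← mul_assoc,
            inv_mul_cancel₀ hd.ne', one_mul]
          exact S2.dist_le_two x y
        have h2 : |κ| * (c⁻¹ * (dist x y)⁻¹) ≤ |κ| * (c⁻¹ * (2 * (dist x y ^ 2)⁻¹)) := by gcongr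
        linarith
    _ = _ := by rw [Real.rpow_neg hd.le, Real.rpow_two]

/-- The kernel splits into a term with `g (q y) - g (q x)`, of order `d^α`, and one with `ν(y) -
ν(x)`, of order `d` and hence `d^α` on the bounded sphere. Each multiplies a gradient of order
`d^(-2)`. -/
theorem exists_norm_tangentialKernel_le (κ : ℝ) (hq : SphereContDiff 2 q)
    (hJ : ∀ x, Jac q x ≠ 0) (hg : ContinuousOn g (Set.range q)) {C α : NNReal} (hα : α ≤ 1)
    (hH : HolderOnWith C α g (Set.range q)) {c : ℝ} (hc : 0 < c) :
    ∃ B : ℝ, ∀ (x y : S2) (z : E3), y ≠ x → c * dist x y ≤ ‖z - q y‖ →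
      ‖tangentialKernel κ q g z x y‖ ≤ B * dist x y ^ (-(2 - (α : ℝ))) := by
  obtain ⟨Bg, hBg0, hBg⟩ := exists_norm_le_of_continuous
    (hg.comp_continuous hq.continuous fun y => ⟨y, rfl⟩)
  obtain ⟨BJ, hBJ0, hBJ⟩ := exists_norm_le_of_continuous (continuous_Jac hq)
  obtain ⟨Kq, hKq0, hKq⟩ := (hq.of_le (m := 1) (by norm_num)).exists_lipschitz
  obtain ⟨KN, hKN0, hKN⟩ := (normalQ_sphereContDiff hq hJ).exists_lipschitz
  set A : ℝ := (c ^ 2)⁻¹ + |κ| * (2 * c⁻¹)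
  have hA0 : 0 ≤ A := by positivity
  refine ⟨BJ * ((C * Kq ^ (α : ℝ) + Bg * (KN * 2)) * 2 * A), fun x y z hxy hz => ?_⟩
  have hd : 0 < dist x y := dist_pos.2 hxy.symm
  set d := dist x y
  set D := fderiv ℝ (helmholtz κ) (z - q y)
  have hD : ‖D‖ ≤ A * d ^ (-2 : ℝ) := norm_fderiv_helmholtz_le_of_chord κ hc hxy hz
  have hG : ‖g (q y) - g (q x)‖ ≤ C * Kq ^ (α : ℝ) * d ^ (α : ℝ) := by
    rw [norm_sub_rev, ← dist_eq_norm]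
    refine (hH.dist_le ⟨x, rfl⟩ ⟨y, rfl⟩).trans ?_
    rw [mul_assoc, ← Real.mul_rpow hKq0 hd.le, dist_eq_norm]
    gcongr
    exact hKq x y
  have hN : ‖normalQ q y - normalQ q x‖ ≤ KN * 2 * d ^ (α : ℝ) := by
    rw [norm_sub_rev]
    refine (hKN x y).trans ?_
    rw [mul_assoc]
    have h1 : d = d ^ (1 - (α : ℝ)) * d ^ (α : ℝ) := by
      rw [← Real.rpow_add hd, sub_add_cancel, Real.rpow_one]
    have hα' : (α : ℝ) ≤ 1 := by exact_mod_cast hα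
    have h2 : d ^ (1 - (α : ℝ)) ≤ 2 := by
      calc d ^ (1 - (α : ℝ)) ≤ 2 ^ (1 - (α : ℝ)) :=
            Real.rpow_le_rpow hd.le (S2.dist_le_two x y) (by linarith)
        _ ≤ 2 ^ (1 : ℝ) := Real.rpow_le_rpow_of_exponent_le one_le_two (by
            have : (0 : ℝ) ≤ α := α.2
            linarith)
        _ = 2 := Real.rpow_one 2
    have h3 : d ≤ 2 * d ^ (α : ℝ) := by
      conv_lhs => rw [h1]
      gcongr
    gcongr
  have h1 : tangentialKernel κ q g z x y = (Jac q y : ℂ) •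
      ((g (q y) - g (q x)) • crossGrad (normalQ q x) D -
        g (q x) • crossGrad (normalQ q y - normalQ q x) D) := by
    rw [tangentialKernel, map_sub, sub_apply]
    module
  have hle : ∀ n : E3, ‖crossGrad n D‖ ≤ 2 * ‖n‖ * ‖D‖ := fun n => norm_crossGrad_le n D
  rw [h1, norm_smul, Complex.norm_real, mul_assoc BJ]
  refine mul_le_mul (hBJ y) ?_ (norm_nonneg _) hBJ0
  calc ‖(g (q y) - g (q x)) • crossGrad (normalQ q x) D -
        g (q x) • crossGrad (normalQ q y - normalQ q x) D‖
      ≤ ‖g (q y) - g (q x)‖ * ‖crossGrad (normalQ q x) D‖ +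
        ‖g (q x)‖ * ‖crossGrad (normalQ q y - normalQ q x) D‖ := by
        rw [← norm_smul, ← norm_smul]; exact norm_sub_le _ _
    _ ≤ (C * Kq ^ (α : ℝ) * d ^ (α : ℝ)) * (2 * 1 * (A * d ^ (-2 : ℝ))) +
        Bg * (2 * (KN * 2 * d ^ (α : ℝ)) * (A * d ^ (-2 : ℝ))) := by
        have e1 := hle (normalQ q x)
        rw [norm_normalQ (hJ x)] at e1
        have e2 := hle (normalQ q y - normalQ q x)
        gcongr
        · exact e1.trans (by gcongr)
        · exact hBg x
        · exact e2.trans (by gcongr)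
    _ = _ := by
        have : d ^ (-(2 - (α : ℝ))) = d ^ (α : ℝ) * d ^ (-2 : ℝ) := by
          rw [← Real.rpow_add hd]; congr 1; ring
        rw [this]
        ring

/-- Truncation of a real number to the interval `[-h₀, h₀]`. -/
noncomputable def clampTo (h₀ h : ℝ) : ℝ := max (-h₀) (min h₀ h)

theorem abs_clampTo_le {h₀ : ℝ} (hh : 0 < h₀) (h : ℝ) : |clampTo h₀ h| ≤ h₀ :=
  abs_le.2 ⟨le_max_left _ _, max_le (by linarith) (min_le_left _ _)⟩

theorem clampTo_eq {h₀ h : ℝ} (hh : |h| ≤ h₀) : clampTo h₀ h = h := by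
  rw [abs_le] at hh
  rw [clampTo, min_eq_right hh.2, max_eq_right hh.1]

theorem continuous_clampTo (h₀ : ℝ) : Continuous (clampTo h₀) := by
  unfold clampTo
  fun_prop

/-- The point at distance `h` along the normal. -/
noncomputable def offsetPoint (q : S2 → E3) (h : ℝ) (x : S2) : E3 := q x + h • normalQ q x

theorem continuous_offsetPoint (hq : SphereContDiff 2 q) (hJ : ∀ x, Jac q x ≠ 0) (h₀ : ℝ) :
    Continuous fun p : ℝ × S2 => offsetPoint q (clampTo h₀ p.1) p.2 :=
  (hq.continuous.comp continuous_snd).add (((continuous_clampTo h₀).comp continuous_fst).smul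
    ((normalQ_sphereContDiff hq hJ).continuous.comp continuous_snd))

/-- Clamping `h` makes the tube bound available on all of `ℝ × S2`. The value `h = 0` is included,
where the regularized integral still converges although `layerGrad` is not under control. -/
theorem continuous_integral_tangentialKernel (κ : ℝ) (hq : SphereContDiff 2 q)
    (hJ : ∀ x, Jac q x ≠ 0) (hg : ContinuousOn g (Set.range q)) {C α : NNReal} (hα0 : 0 < α)
    (hα : α ≤ 1) (hH : HolderOnWith C α g (Set.range q)) {c h₀ : ℝ} (hh₀ : 0 < h₀) (hc : 0 < c)
    (htube : ∀ (x y : S2) (h : ℝ), |h| ≤ h₀ → c * dist x y ≤ ‖offsetPoint q h x - q y‖) :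
    Continuous fun p : ℝ × S2 =>
      ∫ y, tangentialKernel κ q g (offsetPoint q (clampTo h₀ p.1) p.2) p.2 y ∂sphereMeasure := by
  obtain ⟨B, hB⟩ := exists_norm_tangentialKernel_le κ hq hJ hg hα hH hc
  have hα0' : (0 : ℝ) < α := hα0
  have hα' : (α : ℝ) ≤ 1 := by exact_mod_cast hα
  have htube' := fun (p : ℝ × S2) y => htube p.2 y _ (abs_clampTo_le hh₀ p.1)
  have hne : ∀ (p : ℝ × S2) (y : S2), y ≠ p.2 →
      offsetPoint q (clampTo h₀ p.1) p.2 - q y ≠ 0 := fun p y hy =>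
    norm_pos_iff.1 (lt_of_lt_of_le (mul_pos hc (dist_pos.2 hy.symm)) (htube' p y))
  have hN := (normalQ_sphereContDiff hq hJ).continuous
  have hG := hg.comp_continuous hq.continuous fun y => ⟨y, rfl⟩
  refine continuous_integral_of_weaklySingular continuous_snd (β := 2 - α) (C := B)
    (by linarith) (by linarith) (fun p y hy => hB _ _ _ hy (htube' p y)) (fun p => ?_)
    (fun p y hy => ?_)
  · refine fun y hy => ContinuousAt.continuousWithinAt ?_
    have hD : ContinuousAt (fun y => fderiv ℝ (helmholtz κ)
        (offsetPoint q (clampTo h₀ p.1) p.2 - q y)) y :=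
      ContinuousAt.comp (g := fderiv ℝ (helmholtz κ)) (continuousAt_fderiv_helmholtz κ (hne p y hy))
        (continuous_const.sub hq.continuous).continuousAt
    exact (Complex.continuous_ofReal.comp (continuous_Jac hq)).continuousAt.fun_smul
      ((hG.continuousAt.fun_smul ((crossGrad (normalQ q p.2)).continuous.continuousAt.comp hD)).fun_sub
        (continuousAt_const.fun_smul
          ((crossGrad.continuous.comp hN).continuousAt.clm_apply hD)))
  · have hD : ContinuousAt (fun p : ℝ × S2 => fderiv ℝ (helmholtz κ)
        (offsetPoint q (clampTo h₀ p.1) p.2 - q y)) p :=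
      ContinuousAt.comp (g := fderiv ℝ (helmholtz κ)) (continuousAt_fderiv_helmholtz κ (hne p y hy))
        ((continuous_offsetPoint hq hJ h₀).sub continuous_const).continuousAt
    exact continuousAt_const.fun_smul ((continuousAt_const.fun_smul
      ((crossGrad.continuous.comp (hN.comp continuous_snd)).continuousAt.clm_apply hD)).fun_sub
        ((hG.comp continuous_snd).continuousAt.fun_smul
          ((crossGrad (normalQ q y)).continuous.continuousAt.comp hD)))

theorem tangentialGradAt_eq_integral (κ : ℝ) (hq : SphereContDiff 2 q)
    (hinj : Function.Injective q) (hJ : ∀ x, Jac q x ≠ 0) (hg : ContinuousOn g (Set.range q))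
    {h : ℝ} {x : S2} (hz : offsetPoint q h x ∉ Set.range q) :
    tangentialGradAt κ q g h (q x) =
      (2 : ℂ) • ∫ y, tangentialKernel κ q g (offsetPoint q h x) x y ∂sphereMeasure := by
  rw [tangentialGradAt_eq κ hinj, ← crossGrad_layerGrad κ hq hJ hg hz,
    ← (hasFDerivAt_layerPotential κ hq hinj hg hz).fderiv]
  rfl

theorem offsetPoint_notMem_range {h₀ c : ℝ} (htube : ∀ (x y : S2) (h : ℝ), |h| ≤ h₀ →
      c * dist x y ≤ ‖q x + h • normalQ q x - q y‖ ∧ |h| ≤ ‖q x + h • normalQ q x - q y‖)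
    {h : ℝ} (hh : h ≠ 0) (hh₀ : |h| ≤ h₀) (x : S2) : offsetPoint q h x ∉ Set.range q := by
  rintro ⟨y, hy⟩
  have h1 := (htube x y h hh₀).2
  rw [hy, offsetPoint, sub_self, norm_zero] at h1
  exact hh (abs_eq_zero.1 (le_antisymm h1 (abs_nonneg h)))

theorem eventually_abs_le {h₀ : ℝ} (hh₀ : 0 < h₀) : ∀ᶠ h in 𝓝[≠] (0 : ℝ), h ≠ 0 ∧ |h| ≤ h₀ := by
  have h1 : ∀ᶠ h in 𝓝[≠] (0 : ℝ), |h| < h₀ :=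
    nhdsWithin_le_nhds (continuous_abs.continuousAt.eventually (gt_mem_nhds (by simpa using hh₀)))
  filter_upwards [h1, self_mem_nhdsWithin] with h h2 h3
  exact ⟨h3, h2.le⟩

/-- For Hölder continuous densities, the tangential gradient of the layer potential converges
uniformly from both sides of the surface. -/
theorem tendstoUniformlyOn_tangentialGradAt (κ : ℝ) (hq : SphereContDiff 2 q)
    (hinj : Function.Injective q) (hJ : ∀ x, Jac q x ≠ 0) (hg : ContinuousOn g (Set.range q))
    {C α : NNReal} (hα0 : 0 < α) (hα : α ≤ 1) (hH : HolderOnWith C α g (Set.range q)) :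
    TendstoUniformlyOn (tangentialGradAt κ q g) (opH κ q g) (𝓝[≠] (0 : ℝ)) (Set.range q) := by
  obtain ⟨h₀, hh₀, c, hc, htube⟩ := exists_tube_le hq hinj hJ
  let T : ℝ → S2 → Fin 3 → ℂ := fun h x =>
    (2 : ℂ) • ∫ y, tangentialKernel κ q g (offsetPoint q (clampTo h₀ h) x) x y ∂sphereMeasure
  have hT : Continuous fun p : ℝ × S2 => T p.1 p.2 := (continuous_integral_tangentialKernel κ hq hJ hg hα0 hα hH hh₀ hc
    fun x y h hh => (htube x y h hh).1).fun_const_smul (2 : ℂ)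
  -- Joint continuity becomes uniform convergence because the sphere is compact.
  have hTu : TendstoUniformly T (T 0) (𝓝 0) := Continuous.tendstoUniformly T hT 0
  have heq : ∀ᶠ h in 𝓝[≠] (0 : ℝ), ∀ x, tangentialGradAt κ q g h (q x) = T h x := by
    filter_upwards [eventually_abs_le hh₀] with h hh x
    rw [tangentialGradAt_eq_integral κ hq hinj hJ hg (offsetPoint_notMem_range htube hh.1 hh.2 x)]
    simp only [T, clampTo_eq hh.2]
  have hop : ∀ x, opH κ q g (q x) = T 0 x := by
    intro x
    refine Tendsto.limUnder_eq ?_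
    have h1 : Tendsto (fun h => T h x) (𝓝[>] 0) (𝓝 (T 0 x)) :=
      (hTu.tendsto_at x).mono_left nhdsWithin_le_nhds
    refine h1.congr' ?_
    filter_upwards [heq.filter_mono (nhdsWithin_mono 0 fun h (hh : 0 < h) => hh.ne')] with h hh
    exact (hh x).symm
  intro u hu
  filter_upwards [heq, nhdsWithin_le_nhds (hTu u hu)] with h h1 h2
  rintro _ ⟨x, rfl⟩
  rw [h1 x, hop x]
  exact h2 x

end BoundaryLimit

/-! ### Partial integration on the sphere. -/

section PartialIntegration

variable {F : Type*} [NormedAddCommGroup F] [NormedSpace ℝ F]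

theorem Continuous.wedge {X : Type*} [TopologicalSpace X] {L : X → E3 →L[ℝ] ℝ}
    {M : X → E3 →L[ℝ] F} {w : X → E3} (hL : Continuous L) (hM : Continuous M) (hw : Continuous w) :
    Continuous fun x => wedge (L x) (M x) (w x) := by
  have hL' : ∀ v, Continuous fun x => L x v := fun v => hL.clm_apply continuous_const
  have hM' : ∀ v, Continuous fun x => M x v := fun v => hM.clm_apply continuous_const
  have hw' : ∀ i : Fin 3, Continuous fun x => w x i := fun i =>
    (EuclideanSpace.proj i : E3 →L[ℝ] ℝ).continuous.comp hw
  unfold _root_.wedge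
  exact (((hw' 0).fun_smul (((hL' _).fun_smul (hM' _)).fun_sub ((hL' _).fun_smul (hM' _)))).fun_add
    ((hw' 1).fun_smul (((hL' _).fun_smul (hM' _)).fun_sub ((hL' _).fun_smul (hM' _))))).fun_add
    ((hw' 2).fun_smul (((hL' _).fun_smul (hM' _)).fun_sub ((hL' _).fun_smul (hM' _))))

theorem tderiv_mul {b c : S2 → ℂ} (hb : SphereContDiff 1 b) (hc : SphereContDiff 1 c) (x : S2) :
    tderiv (fun y => b y * c y) x = b x • tderiv c x + c x • tderiv b x := by
  have h1 : HasFDerivAt (fun w => radialExt b w * radialExt c w)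
      (radialExt b x • tderiv c x + radialExt c x • tderiv b x) (x : E3) :=
    (hb.hasFDerivAt x).mul (hc.hasFDerivAt x)
  rw [radialExt_coe, radialExt_coe] at h1
  refine (h1.congr_of_eventuallyEq ?_).fderiv
  filter_upwards [isOpen_compl_zero.mem_nhds (S2.coe_ne_zero x)] with w hw
  have hw : w ≠ 0 := hw
  simp [radialExt, hw]

theorem wedge_tderiv_mul (L : E3 →L[ℝ] ℝ) {b c : S2 → ℂ} (hb : SphereContDiff 1 b)
    (hc : SphereContDiff 1 c) (x : S2) (w : E3) :
    wedge L (tderiv (fun y => b y * c y) x) w =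
      wedge L (tderiv b x) w * c x + b x * wedge L (tderiv c x) w := by
  rw [tderiv_mul hb hc]
  simp only [wedge, add_apply, smul_apply, smul_eq_mul, Complex.real_smul]
  ring

theorem continuous_wedge_tderiv {a : S2 → ℝ} {b : S2 → F} (ha : SphereContDiff 1 a)
    (hb : SphereContDiff 1 b) : Continuous fun x : S2 => wedge (tderiv a x) (tderiv b x) (x : E3) :=
  ha.continuous_tderiv.wedge hb.continuous_tderiv continuous_subtype_val

/-- Stokes' theorem for `da ∧ d(bc)` and the product rule. -/
theorem integral_wedge_tderiv_mul {a : S2 → ℝ} {b c : S2 → ℂ} (ha : SphereContDiff 1 a)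
    (hb : SphereContDiff 1 b) (hc : SphereContDiff 1 c) :
    ∫ x : S2, wedge (tderiv a x) (tderiv b x) (x : E3) * c x ∂sphereMeasure =
      - ∫ x : S2, b x * wedge (tderiv a x) (tderiv c x) (x : E3) ∂sphereMeasure := by
  have h := integral_wedge_tderiv ha (hb.mul hc)
  simp only [wedge_tderiv_mul _ hb hc] at h
  rw [integral_add ((continuous_wedge_tderiv ha hb).fun_mul hc.continuous).integrable_sphere
    (hb.continuous.fun_mul (continuous_wedge_tderiv ha hc)).integrable_sphere] at h
  exact eq_neg_of_add_eq_zero_left h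

end PartialIntegration

/-! ### Parallel surfaces and the identity at distance `h`. -/

section ParallelSurface

variable {q : S2 → E3} {g : E3 → ℂ}

/-- The normal costs one derivative, so a `C²` surface has only `C¹` parallel surfaces. -/
theorem offsetPoint_sphereContDiff (hq : SphereContDiff 2 q) (hJ : ∀ x, Jac q x ≠ 0) (h : ℝ) :
    SphereContDiff 1 (offsetPoint q h) :=
  (hq.of_le (by norm_num)).add
    ((normalQ_sphereContDiff hq hJ).clm_comp (h • ContinuousLinearMap.id ℝ E3))

/-- The derivative of the parametrization of the parallel surface. -/
noncomputable def offsetDeriv (q : S2 → E3) (h : ℝ) (x : S2) : E3 →L[ℝ] E3 :=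
  tderiv q x + h • tderiv (normalQ q) x

theorem tderiv_offsetPoint (hq : SphereContDiff 2 q) (hJ : ∀ x, Jac q x ≠ 0) (h : ℝ) (x : S2) :
    tderiv (offsetPoint q h) x = offsetDeriv q h x := by
  have h1 : SphereContDiff 1 q := hq.of_le (by norm_num)
  have h2 := normalQ_sphereContDiff hq hJ
  have h3 : tderiv (offsetPoint q h) x = _ := tderiv_comp (h1.prodMk h2)
    (u := fun p : E3 × E3 => p.1 + h • p.2) (x := x)
    ((ContinuousLinearMap.fst ℝ E3 E3 + h • ContinuousLinearMap.snd ℝ E3 E3).hasFDerivAt)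
  rw [h3, tderiv_prodMk h1 h2]
  rfl

theorem continuous_offsetDeriv (hq : SphereContDiff 2 q) (hJ : ∀ x, Jac q x ≠ 0) :
    Continuous fun p : ℝ × S2 => offsetDeriv q p.1 p.2 :=
  ((hq.of_le (m := 1) (by norm_num)).continuous_tderiv.comp continuous_snd).add
    (continuous_fst.fun_smul ((normalQ_sphereContDiff hq hJ).continuous_tderiv.comp continuous_snd))

theorem cross3_eq_smul_of_orthogonal {n a b : E3} (hn : ‖n‖ = 1) (ha : inner ℝ n a = 0)
    (hb : inner ℝ n b = 0) : cross3 a b = inner ℝ n (cross3 a b) • n := by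
  have hn' : n 0 ^ 2 + n 1 ^ 2 + n 2 ^ 2 = 1 := by
    rw [EuclideanSpace.norm_eq, Real.sqrt_eq_one, Fin.sum_univ_three] at hn
    simpa using hn
  have hin : ∀ c : E3, inner ℝ n c = c 0 * n 0 + c 1 * n 1 + c 2 * n 2 := fun c => by
    simp [PiLp.inner_apply, Fin.sum_univ_three]
  rw [hin] at ha hb
  rw [hin]
  ext i
  fin_cases i <;> simp
  · linear_combination (-(a 1 * b 2 - a 2 * b 1)) * hn' - (n 1 * a 2 - n 2 * a 1) * hb +
      (n 1 * b 2 - n 2 * b 1) * ha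
  · linear_combination (-(a 2 * b 0 - a 0 * b 2)) * hn' - (n 2 * a 0 - n 0 * a 2) * hb +
      (n 2 * b 0 - n 0 * b 2) * ha
  · linear_combination (-(a 0 * b 1 - a 1 * b 0)) * hn' - (n 0 * a 1 - n 1 * a 0) * hb +
      (n 0 * b 1 - n 1 * b 0) * ha

/-- The oriented Jacobian of the parallel surface. -/
noncomputable def offsetJac (q : S2 → E3) (h : ℝ) (x : S2) : ℝ :=
  inner ℝ (normalQ q x) (cofactorMap (offsetDeriv q h x) x)

/-- Both parts of `offsetDeriv` map into the plane orthogonal to `ν`, so the cross product of two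
image vectors is a multiple of `ν`. Neither its sign nor its nonvanishing matters later. -/
theorem crossNormal_offsetPoint (hq : SphereContDiff 2 q) (hJ : ∀ x, Jac q x ≠ 0) (h : ℝ)
    (x : S2) : crossNormal (offsetPoint q h) x = offsetJac q h x • normalQ q x := by
  have h1 : ∀ v, inner ℝ (normalQ q x) (offsetDeriv q h x v) = 0 := fun v => by
    rw [offsetDeriv, add_apply, smul_apply, inner_add_right, inner_smul_right,
      inner_normalQ_tderiv (hq.of_le (by norm_num)), inner_normalQ_tderiv_normalQ hq hJ, mul_zero,
      add_zero]
  rw [crossNormal_eq, tderiv_offsetPoint hq hJ, offsetJac]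
  have h2 := cross3_map_map (offsetDeriv q h x) (eTheta x) (ePhi x)
  rw [cross3_eTheta_ePhi] at h2
  rw [← h2]
  exact cross3_eq_smul_of_orthogonal (norm_normalQ (hJ x)) (h1 _) (h1 _)

theorem continuous_offsetJac (hq : SphereContDiff 2 q) (hJ : ∀ x, Jac q x ≠ 0) :
    Continuous fun p : ℝ × S2 => offsetJac q p.1 p.2 :=
  ((normalQ_sphereContDiff hq hJ).continuous.comp continuous_snd).inner
    ((contDiff_cofactorMap (n := 0)).continuous.comp ((continuous_offsetDeriv hq hJ).prodMk
      (continuous_subtype_val.comp continuous_snd)))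

theorem offsetJac_zero (hJ : ∀ x, Jac q x ≠ 0) (x : S2) : offsetJac q 0 x = Jac q x := by
  rw [offsetJac, offsetDeriv, zero_smul, add_zero, ← crossNormal_eq, ← Jac_smul_normalQ (hJ x),
    inner_smul_right, real_inner_self_eq_norm_sq, norm_normalQ (hJ x), one_pow, mul_one]

/-- The pairing of the derivative of the parallel surface with the surface curl of a test field. -/
noncomputable def curlPairing (q : S2 → E3) (f : S2 → Fin 3 → ℂ) (h : ℝ) (x : S2) : ℂ :=
  ∑ j, wedge (compL (offsetDeriv q h x) j) (tderiv (fun y => f y j) x) (x : E3)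

theorem continuous_curlPairing (hq : SphereContDiff 2 q) (hJ : ∀ x, Jac q x ≠ 0)
    {f : S2 → Fin 3 → ℂ} (hf : ∀ j, SphereContDiff 1 fun y => f y j) :
    Continuous fun p : ℝ × S2 => curlPairing q f p.1 p.2 := by
  refine continuous_finsetSum _ fun j _ => Continuous.wedge ?_
    ((hf j).continuous_tderiv.comp continuous_snd) (continuous_subtype_val.comp continuous_snd)
  exact continuous_const.clm_comp (continuous_offsetDeriv hq hJ)

/-- Multiplication by the oriented Jacobian turns `ν × ∇V` into the normal of the parallel surface
crossed with the gradient, whose components are two-forms on the sphere. Partial integration in each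
component then leaves `V` undifferentiated; its sign cancels that of `crossGrad_crossNormal`. -/
theorem integral_offsetJac_mul (κ : ℝ) (hq : SphereContDiff 2 q)
    (hinj : Function.Injective q) (hJ : ∀ x, Jac q x ≠ 0) (hg : ContinuousOn g (Set.range q))
    {h : ℝ} (hz : ∀ x, offsetPoint q h x ∉ Set.range q) {f : S2 → Fin 3 → ℂ}
    (hf : ∀ j, SphereContDiff 1 fun y => f y j) :
    ∫ x, (offsetJac q h x : ℂ) * (tangentialGradAt κ q g h (q x) ⬝ᵥ f x) ∂sphereMeasure =
      2 * ∫ x, layerPotential κ q g (offsetPoint q h x) * curlPairing q f h x ∂sphereMeasure := by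
  have hp := offsetPoint_sphereContDiff hq hJ h
  have hpj : ∀ j, SphereContDiff 1 fun y => offsetPoint q h y j := fun j =>
    hp.clm_comp (EuclideanSpace.proj j : E3 →L[ℝ] ℝ)
  have hW : SphereContDiff 1 fun y => layerPotential κ q g (offsetPoint q h y) :=
    hp.comp fun x => contDiffAt_layerPotential κ hq hinj hg (hz x)
  have hLj : ∀ j x, tderiv (fun y => offsetPoint q h y j) x = compL (offsetDeriv q h x) j := by
    intro j x
    rw [← tderiv_offsetPoint hq hJ]
    exact tderiv_comp hp (EuclideanSpace.proj j : E3 →L[ℝ] ℝ).hasFDerivAt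
  have h1 : ∀ x, (offsetJac q h x : ℂ) * (tangentialGradAt κ q g h (q x) ⬝ᵥ f x) =
      ∑ j, (-2 : ℂ) * (wedge (tderiv (fun y => offsetPoint q h y j) x)
        (tderiv (fun y => layerPotential κ q g (offsetPoint q h y)) x) (x : E3) * f x j) := by
    intro x
    have hV : HasFDerivAt (layerPotential κ q g) (fderiv ℝ (layerPotential κ q g)
        (offsetPoint q h x)) (offsetPoint q h x) :=
      ((contDiffAt_layerPotential κ hq hinj hg (hz x)).differentiableAt one_ne_zero).hasFDerivAt
    rw [tangentialGradAt_eq κ hinj, dotProduct, Finset.mul_sum]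
    refine Finset.sum_congr rfl fun j _ => ?_
    have h2 := crossGrad_crossNormal hp hV j
    rw [crossNormal_offsetPoint hq hJ, map_smul] at h2
    rw [eq_neg_iff_add_eq_zero, add_comm, ← eq_neg_iff_add_eq_zero] at h2
    rw [h2]
    simp only [smul_apply, Pi.smul_apply, smul_eq_mul, Complex.real_smul, offsetPoint]
    ring
  have h3 : ∀ x, layerPotential κ q g (offsetPoint q h x) * curlPairing q f h x =
      ∑ j, layerPotential κ q g (offsetPoint q h x) *
        wedge (tderiv (fun y => offsetPoint q h y j) x) (tderiv (fun y => f y j) x) (x : E3) := by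
    intro x
    simp only [curlPairing, Finset.mul_sum, hLj]
  simp only [h1, h3]
  rw [integral_finsetSum, integral_finsetSum, Finset.mul_sum]
  · refine Finset.sum_congr rfl fun j _ => ?_
    rw [integral_const_mul, integral_wedge_tderiv_mul (hpj j) hW (hf j)]
    ring
  · exact fun j _ => (hW.continuous.mul (continuous_wedge_tderiv (hpj j) (hf j))).integrable_sphere
  · exact fun j _ => (continuous_const.mul ((continuous_wedge_tderiv (hpj j) hW).mul
      (hf j).continuous)).integrable_sphere

/-- The kernel is of order `d^(-1)` uniformly in `h`, so continuity of the density suffices here. -/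
theorem continuous_layerPotential_offset (κ : ℝ) (hq : SphereContDiff 2 q)
    (hinj : Function.Injective q) (hJ : ∀ x, Jac q x ≠ 0) (hg : ContinuousOn g (Set.range q))
    {c h₀ : ℝ} (hh₀ : 0 < h₀) (hc : 0 < c)
    (htube : ∀ (x y : S2) (h : ℝ), |h| ≤ h₀ → c * dist x y ≤ ‖offsetPoint q h x - q y‖) :
    Continuous fun p : ℝ × S2 => layerPotential κ q g (offsetPoint q (clampTo h₀ p.1) p.2) := by
  have hμ := continuous_layerDensity hq hg
  obtain ⟨B, hB0, hB⟩ := exists_norm_le_of_continuous hμ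
  have htube' := fun (p : ℝ × S2) y => htube p.2 y _ (abs_clampTo_le hh₀ p.1)
  have hne : ∀ (p : ℝ × S2) (y : S2), y ≠ p.2 →
      offsetPoint q (clampTo h₀ p.1) p.2 - q y ≠ 0 := fun p y hy =>
    norm_pos_iff.1 (lt_of_lt_of_le (mul_pos hc (dist_pos.2 hy.symm)) (htube' p y))
  have hψ : ∀ w : E3, w ≠ 0 → ContinuousAt (helmholtz κ) w := fun w hw =>
    (contDiffAt_helmholtz κ (n := 0) hw).continuousAt
  simp only [layerPotential_eq κ hq hinj g]
  refine continuous_integral_of_weaklySingular continuous_snd (β := 1) (C := c⁻¹ * B)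
    one_pos one_lt_two (fun p y hy => ?_) (fun p y hy => ?_) (fun p y hy => ?_)
  · have hd : 0 < dist p.2 y := dist_pos.2 hy.symm
    rw [norm_mul, Real.rpow_neg_one]
    calc ‖helmholtz κ (offsetPoint q (clampTo h₀ p.1) p.2 - q y)‖ * ‖layerDensity q g y‖
        ≤ (c * dist p.2 y)⁻¹ * B := by
          refine mul_le_mul ((norm_helmholtz_le κ _).trans ?_) (hB y) (norm_nonneg _)
            (by positivity)
          exact inv_anti₀ (by positivity) (htube' p y)
      _ = _ := by rw [mul_inv]; ring
  · have h1 : ContinuousAt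
        (fun y => helmholtz κ (offsetPoint q (clampTo h₀ p.1) p.2 - q y)) y :=
      ContinuousAt.comp (g := helmholtz κ)
        (f := fun y => offsetPoint q (clampTo h₀ p.1) p.2 - q y) (hψ _ (hne p y hy))
        (continuous_const.fun_sub hq.continuous).continuousAt
    exact (h1.fun_mul hμ.continuousAt).continuousWithinAt
  · have h1 : ContinuousAt (fun p : ℝ × S2 =>
        helmholtz κ (offsetPoint q (clampTo h₀ p.1) p.2 - q y)) p :=
      ContinuousAt.comp (g := helmholtz κ)
        (f := fun p : ℝ × S2 => offsetPoint q (clampTo h₀ p.1) p.2 - q y) (hψ _ (hne p y hy))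
        ((continuous_offsetPoint hq hJ h₀).fun_sub continuous_const).continuousAt
    exact h1.fun_mul continuousAt_const

end ParallelSurface

/-! ### Identification of the parametrized operators. -/

section ParametrizedOperators

variable {q : S2 → E3} {g : E3 → ℂ}

/-- The factors `|x - y|` cancel, Euler's formula combines cosine and sine, and the `2` comes from
`1 / 2π` against `1 / 4π`. -/
theorem opS_integrand_eq (κ : ℝ) (hinj : Function.Injective q) {x y : S2} (hxy : y ≠ x) :
    ((1 / ‖(x : E3) - (y : E3)‖ : ℝ) * kerS1 κ q x y + kerS2 κ q x y) * (g ∘ q) y =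
      2 * (helmholtz κ (q x - q y) * layerDensity q g y) := by
  have hd : ((‖(x : E3) - (y : E3)‖ : ℝ) : ℂ) ≠ 0 := by
    rw [Complex.ofReal_ne_zero, ← S2.dist_eq]
    exact dist_ne_zero.2 hxy.symm
  have hne : q x ≠ q y := hinj.ne hxy.symm
  have hr : ((‖q x - q y‖ : ℝ) : ℂ) ≠ 0 := by
    rw [Complex.ofReal_ne_zero]
    exact norm_ne_zero_iff.2 (sub_ne_zero.2 hne)
  have hpi : (Real.pi : ℂ) ≠ 0 := Complex.ofReal_ne_zero.2 Real.pi_ne_zero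
  have hexp : Complex.exp (Complex.I * κ * ‖q x - q y‖) =
      Complex.cos (κ * ‖q x - q y‖) + Complex.sin (κ * ‖q x - q y‖) * Complex.I := by
    rw [← Complex.exp_mul_I]
    congr 1
    ring
  rw [kerS1, kerS2, s1, s2, if_neg hne, ratioR, helmholtz, layerDensity, hexp]
  push_cast
  simp only [Function.comp_apply]
  field_simp
  ring

theorem opS_eq_layerPotential (κ : ℝ) (hq : SphereContDiff 2 q) (hinj : Function.Injective q)
    (x : S2) : opS κ q (g ∘ q) x = 2 * layerPotential κ q g (q x) := by
  rw [opS, layerPotential_eq κ hq hinj, ← integral_const_mul]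
  refine integral_congr_ae ?_
  filter_upwards [compl_mem_ae_iff.2 (sphereMeasure_singleton x)] with y hy
  exact opS_integrand_eq κ hinj hy

theorem crossProduct_toC3 (a b : E3) : crossProduct (toC3 a) (toC3 b) = toC3 (cross3 a b) := by
  ext i
  fin_cases i <;> simp [crossProduct, toC3]

theorem curlS2_eq (w : S2 → ℂ) (x : S2) (i : Fin 3) : curlS2 w x i =
    tderiv w x (ePhi x) * (eTheta x i : ℂ) - tderiv w x (eTheta x) * (ePhi x i : ℂ) := by
  rw [curlS2, gradS2, map_add, map_smul, map_smul, LinearMap.add_apply, LinearMap.smul_apply,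
    LinearMap.smul_apply, crossProduct_toC3, crossProduct_toC3, cross3_eTheta_coe,
    cross3_ePhi_coe]
  simp [toC3, sphereDeriv_eq_tderiv]
  ring

theorem frame_orthonormal (x : S2) :
    eTheta x 0 ^ 2 + eTheta x 1 ^ 2 + eTheta x 2 ^ 2 = 1 ∧
      eTheta x 0 * ePhi x 0 + eTheta x 1 * ePhi x 1 + eTheta x 2 * ePhi x 2 = 0 := by
  obtain ⟨h1, h2⟩ := ePhi_props x
  have h3 := S2.sq_sum x
  constructor
  · simp [eTheta]
    linear_combination ((x : E3) 0 ^ 2 + (x : E3) 1 ^ 2 + (x : E3) 2 ^ 2) * h1 + h3 -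
      (ePhi x 0 * (x : E3) 0 + ePhi x 1 * (x : E3) 1 + ePhi x 2 * (x : E3) 2) * h2
  · simp [eTheta]
    ring

/-- In the orthonormal frame the gradient of `q_j` is `a e_θ + b e_φ` and the curl of `φ_j` is `c
e_θ - d e_φ`, where `c`, `d` are the derivatives of `φ_j` along `e_φ`, `e_θ`. Their product `ac -
bd` is the two-form on `(e_θ, e_φ)`; the conjugation passes to `φ` because `q` is real. -/
theorem conj_matColon_eq {φ : S2 → Fin 3 → ℂ} (hφ : ∀ j, SphereContDiff 1 fun y => φ y j) (x : S2) :
    conj (matColon ((DS2 q x)ᵀ.map Complex.ofReal) (curlMatS2 φ x)) =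
      curlPairing q (fun y => star (φ y)) 0 x := by
  obtain ⟨h1, h2⟩ := ePhi_props x
  obtain ⟨h3, h4⟩ := frame_orthonormal x
  have h1' : (ePhi x 0 : ℂ) ^ 2 + (ePhi x 1 : ℂ) ^ 2 + (ePhi x 2 : ℂ) ^ 2 = 1 := by
    simpa using congrArg Complex.ofReal h1
  have h3' : (eTheta x 0 : ℂ) ^ 2 + (eTheta x 1 : ℂ) ^ 2 + (eTheta x 2 : ℂ) ^ 2 = 1 := by
    simpa using congrArg Complex.ofReal h3
  have h4' : (eTheta x 0 : ℂ) * (ePhi x 0 : ℂ) + (eTheta x 1 : ℂ) * (ePhi x 1 : ℂ) +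
      (eTheta x 2 : ℂ) * (ePhi x 2 : ℂ) = 0 := by
    simpa using congrArg Complex.ofReal h4
  have hconj : ∀ j v, tderiv (fun y => star (φ y) j) x v = conj (tderiv (fun y => φ y j) x v) := by
    intro j v
    have h5 : tderiv (fun y => star (φ y) j) x = _ :=
      tderiv_comp (hφ j) (Complex.conjCLE : ℂ →L[ℝ] ℂ).hasFDerivAt
    rw [h5]
    rfl
  rw [matColon, curlPairing, map_sum]
  refine Finset.sum_congr rfl fun j _ => ?_
  rw [← cross3_eTheta_ePhi, ← smul_sub_smul_eq_wedge, hconj, hconj, offsetDeriv, zero_smul,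
    add_zero, compL_apply, compL_apply, dotProduct, Fin.sum_univ_three]
  have h6 : ∀ i, ((DS2 q x)ᵀ.map Complex.ofReal).col j i * (curlMatS2 φ x).col j i =
      ((tderiv q x (eTheta x) j : ℂ) * (eTheta x i : ℂ) +
        (tderiv q x (ePhi x) j : ℂ) * (ePhi x i : ℂ)) *
      (tderiv (fun y => φ y j) x (ePhi x) * (eTheta x i : ℂ) -
        tderiv (fun y => φ y j) x (eTheta x) * (ePhi x i : ℂ)) := by
    intro i
    rw [← curlS2_eq]
    simp [DS2, curlMatS2, Matrix.vecMulVec, t1, t2, sphereDeriv_eq_tderiv]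
  rw [h6, h6, h6, Complex.real_smul, Complex.real_smul]
  set a := tderiv q x (eTheta x) j
  set b := tderiv q x (ePhi x) j
  set c := tderiv (fun y => φ y j) x (ePhi x)
  set d := tderiv (fun y => φ y j) x (eTheta x)
  have h7 : (a : ℂ) * conj c - (b : ℂ) * conj d = conj ((a : ℂ) * c - (b : ℂ) * d) := by
    simp
  rw [h7]
  congr 1
  linear_combination (a : ℂ) * c * h3' - (b : ℂ) * d * h1' + ((b : ℂ) * c - (a : ℂ) * d) * h4'

end ParametrizedOperators

/-! ### Passage to the limit `h → 0+` and the theorem. -/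

section VariationalIdentity

variable {q : S2 → E3} {g : E3 → ℂ}

theorem continuous_tangentialGradAt (κ : ℝ) (hq : SphereContDiff 2 q)
    (hinj : Function.Injective q) (hJ : ∀ x, Jac q x ≠ 0) (hg : ContinuousOn g (Set.range q))
    {h : ℝ} (hz : ∀ x, offsetPoint q h x ∉ Set.range q) :
    Continuous fun x => tangentialGradAt κ q g h (q x) := by
  have h1 : ∀ x, tangentialGradAt κ q g h (q x) =
      (2 : ℂ) • crossGrad (normalQ q x) (layerGrad κ q g (offsetPoint q h x)) := by
    intro x
    rw [tangentialGradAt_eq κ hinj, ← (hasFDerivAt_layerPotential κ hq hinj hg (hz x)).fderiv]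
    rfl
  have h2 : Continuous fun x => layerGrad κ q g (offsetPoint q h x) :=
    continuous_iff_continuousAt.2 fun x => ContinuousAt.comp (g := layerGrad κ q g)
      (continuousAt_layerGrad κ hq hg (hz x))
      (offsetPoint_sphereContDiff hq hJ h).continuous.continuousAt
  simp only [h1]
  exact ((crossGrad.continuous.comp (normalQ_sphereContDiff hq hJ).continuous).clm_apply
    h2).fun_const_smul (2 : ℂ)

theorem norm_dotProduct_le (a b : Fin 3 → ℂ) : ‖a ⬝ᵥ b‖ ≤ 3 * (‖a‖ * ‖b‖) := by
  rw [dotProduct]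
  refine (norm_sum_le_of_le _ fun i _ => ?_).trans (b := ∑ _i : Fin 3, ‖a‖ * ‖b‖) ?_
  · rw [norm_mul]
    exact mul_le_mul (norm_le_pi_norm a i) (norm_le_pi_norm b i) (norm_nonneg _) (norm_nonneg _)
  · simp

theorem Continuous.dotProduct_fin {X : Type*} [TopologicalSpace X] {a b : X → Fin 3 → ℂ}
    (ha : Continuous a) (hb : Continuous b) : Continuous fun x => a x ⬝ᵥ b x := by
  unfold dotProduct
  exact continuous_finsetSum _ fun i _ =>
    ((continuous_apply i).comp ha).mul ((continuous_apply i).comp hb)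

theorem continuous_curlPairing_const (hq : SphereContDiff 2 q) (hJ : ∀ x, Jac q x ≠ 0)
    {f : S2 → Fin 3 → ℂ} (hf : ∀ j, SphereContDiff 1 fun y => f y j) (h : ℝ) :
    Continuous fun x => curlPairing q f h x := by
  have h1 := continuous_curlPairing hq hJ hf
  generalize curlPairing q f = F at *
  exact h1.comp (Continuous.prodMk_right (X := ℝ) (Y := S2) h)

theorem tendsto_integral_mul_dotProduct {w : ℝ → S2 → ℝ}
    (hw : Continuous fun p : ℝ × S2 => w p.1 p.2)
    {T : ℝ → S2 → Fin 3 → ℂ} {T₀ f : S2 → Fin 3 → ℂ} (hT : TendstoUniformly T T₀ (𝓝[>] (0 : ℝ)))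
    (hTc : ∀ᶠ h in 𝓝[>] (0 : ℝ), Continuous (T h)) (hT₀ : Continuous T₀) (hf : Continuous f) :
    Tendsto (fun h => ∫ x, (w h x : ℂ) * (T h x ⬝ᵥ f x) ∂sphereMeasure) (𝓝[>] 0)
      (𝓝 (∫ x, (w 0 x : ℂ) * (T₀ x ⬝ᵥ f x) ∂sphereMeasure)) := by
  obtain ⟨B, hB⟩ := (isCompact_Icc.prod isCompact_univ :
    IsCompact (Set.Icc (-1 : ℝ) 1 ×ˢ (Set.univ : Set S2))).exists_bound_of_continuousOn
      hw.continuousOn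
  have hwB : ∀ h x, |h| ≤ 1 → ‖w h x‖ ≤ B := fun h x hh =>
    hB (h, x) ⟨abs_le.1 hh, trivial⟩
  have hB0 : 0 ≤ B := (norm_nonneg _).trans (hwB 0 (Classical.arbitrary S2) (by simp))
  obtain ⟨BT, hBT0, hBT⟩ := exists_norm_le_of_continuous hT₀
  obtain ⟨Bf, hBf0, hBf⟩ := exists_norm_le_of_continuous hf
  have hsmall : ∀ᶠ h in 𝓝[>] (0 : ℝ), h ≠ 0 ∧ |h| ≤ 1 :=
    (eventually_abs_le one_pos).filter_mono (nhdsWithin_mono 0 fun h (hh : 0 < h) => hh.ne')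
  refine tendsto_integral_filter_of_dominated_convergence
    (fun _ => B * (3 * ((BT + 1) * Bf))) ?_ ?_ (integrable_const _) ?_
  · filter_upwards [hTc] with h hh
    have h1 : Continuous fun x => (w h x : ℂ) := Complex.continuous_ofReal.comp
      (hw.comp (Continuous.prodMk_right (X := ℝ) (Y := S2) h))
    exact (h1.fun_mul (hh.dotProduct_fin hf)).aestronglyMeasurable
  · have h1 := Metric.tendstoUniformly_iff.1 hT 1 one_pos
    filter_upwards [hsmall, h1] with h hh hd
    refine Eventually.of_forall fun x => ?_
    have h2 : ‖T h x‖ ≤ BT + 1 := by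
      have h3 := hd x
      rw [dist_eq_norm] at h3
      have h4 := norm_sub_norm_le (T h x) (T₀ x)
      rw [norm_sub_rev] at h4
      linarith [hBT x]
    rw [norm_mul, Complex.norm_real]
    refine mul_le_mul (hwB h x hh.2) ((norm_dotProduct_le _ _).trans ?_) (norm_nonneg _) hB0
    gcongr
    exact hBf x
  · refine Eventually.of_forall fun x => ?_
    have h1 : Continuous fun h : ℝ => (w h x : ℂ) := Complex.continuous_ofReal.comp
      (hw.comp (Continuous.prodMk_left (X := ℝ) (Y := S2) x))
    have h3 : Continuous fun t : Fin 3 → ℂ => t ⬝ᵥ f x :=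
      continuous_id.dotProduct_fin continuous_const
    exact ((h1.tendsto 0).mono_left nhdsWithin_le_nhds).mul
      ((h3.tendsto _).comp (hT.tendsto_at x))

/-- The variational identity for the tangential gradient of the layer potential. -/
theorem continuous_opH_and_integral_eq (κ : ℝ) (hq : SphereContDiff 2 q)
    (hinj : Function.Injective q) (hJ : ∀ x, Jac q x ≠ 0) (hg : ContinuousOn g (Set.range q))
    (hU : TendstoUniformlyOn (tangentialGradAt κ q g) (opH κ q g) (𝓝[>] (0 : ℝ)) (Set.range q))
    {f : S2 → Fin 3 → ℂ} (hf : ∀ j, SphereContDiff 1 fun y => f y j) :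
    (Continuous fun x => opH κ q g (q x)) ∧
    (Continuous fun x => layerPotential κ q g (q x)) ∧
    ∫ x, (Jac q x : ℂ) * (opH κ q g (q x) ⬝ᵥ f x) ∂sphereMeasure =
      2 * ∫ x, layerPotential κ q g (q x) * curlPairing q f 0 x ∂sphereMeasure := by
  obtain ⟨h₀, hh₀, c, hc, htube⟩ := exists_tube_le hq hinj hJ
  have hfc : Continuous f := continuous_pi fun j => (hf j).continuous
  have hTu : TendstoUniformly (fun h x => tangentialGradAt κ q g h (q x))
      (fun x => opH κ q g (q x)) (𝓝[>] (0 : ℝ)) := by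
    intro u hu
    filter_upwards [hU u hu] with h hh x using hh _ ⟨x, rfl⟩
  have hsmall : ∀ᶠ h in 𝓝[>] (0 : ℝ), h ≠ 0 ∧ |h| ≤ h₀ :=
    (eventually_abs_le hh₀).filter_mono (nhdsWithin_mono 0 fun h (hh : 0 < h) => hh.ne')
  have hTc : ∀ᶠ h in 𝓝[>] (0 : ℝ), Continuous fun x => tangentialGradAt κ q g h (q x) := by
    filter_upwards [hsmall] with h hh
    exact continuous_tangentialGradAt κ hq hinj hJ hg
      (offsetPoint_notMem_range htube hh.1 hh.2)
  -- A uniform limit of continuous functions; this is what makes the left integrand integrable.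
  have hHc : Continuous fun x => opH κ q g (q x) := hTu.continuous hTc.frequently
  have hVc : Continuous fun p : ℝ × S2 =>
      layerPotential κ q g (offsetPoint q (clampTo h₀ p.1) p.2) :=
    continuous_layerPotential_offset κ hq hinj hJ hg hh₀ hc fun x y h hh => (htube x y h hh).1
  have hclamp0 : clampTo h₀ 0 = 0 := clampTo_eq (by simpa using hh₀.le)
  have hoff0 : ∀ x, offsetPoint q 0 x = q x := fun x => by simp [offsetPoint]
  have hV0 : Continuous fun x => layerPotential κ q g (q x) := by
    have h1 := hVc.comp (Continuous.prodMk_right (X := ℝ) (Y := S2) 0)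
    simpa [Function.comp_def, hclamp0, hoff0] using h1
  refine ⟨hHc, hV0, ?_⟩
  have hEc := continuous_curlPairing hq hJ hf
  have hR : Tendsto (fun h => 2 * ∫ x, layerPotential κ q g (offsetPoint q (clampTo h₀ h) x) *
      curlPairing q f h x ∂sphereMeasure) (𝓝[>] 0)
      (𝓝 (2 * ∫ x, layerPotential κ q g (q x) * curlPairing q f 0 x ∂sphereMeasure)) := by
    have h1 : Continuous fun h => ∫ x in Set.univ,
        layerPotential κ q g (offsetPoint q (clampTo h₀ h) x) * curlPairing q f h x
        ∂sphereMeasure :=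
      continuous_parametric_integral_of_continuous (hVc.mul hEc) isCompact_univ
    simp only [Measure.restrict_univ] at h1
    have h2 := ((h1.tendsto 0).const_mul 2).mono_left (nhdsWithin_le_nhds (s := Set.Ioi 0))
    simpa only [hclamp0, hoff0] using h2
  -- The weight is the oriented Jacobian, which equals `Jac q` at `h = 0`.
  have hL := tendsto_integral_mul_dotProduct (w := offsetJac q) (continuous_offsetJac hq hJ)
    hTu hTc hHc hfc
  simp only [offsetJac_zero hJ] at hL
  refine tendsto_nhds_unique hL (hR.congr' ?_)
  filter_upwards [hsmall] with h hh
  rw [integral_offsetJac_mul κ hq hinj hJ hg (offsetPoint_notMem_range htube hh.1 hh.2) hf,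
    clampTo_eq hh.2]

end VariationalIdentity

theorem theorem4p2 (κ : ℝ) (hκ : 0 < κ)
    (q : S2 → E3) (hq : ContMDiff (𝓡 2) 𝓘(ℝ, E3) 2 q) (hinj : Function.Injective q)
    (hJ : ∀ x, Jac q x ≠ 0)
    (g : E3 → ℂ) (hg : ContinuousOn g (Set.range q)) :
    -- for Hölder continuous `g`, the limit that defines `Hg` exists uniformly, from both sides
    (∀ (C α : NNReal), 0 < α → α ≤ 1 → HolderOnWith C α g (Set.range q) →
      TendstoUniformlyOn (tangentialGradAt κ q g) (opH κ q g) (𝓝[≠] (0 : ℝ)) (Set.range q)) ∧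
    -- whenever the limit that defines `Hg` exists uniformly, the identity holds
    (TendstoUniformlyOn (tangentialGradAt κ q g) (opH κ q g) (𝓝[>] (0 : ℝ)) (Set.range q) →
      ∀ φ : S2 → Fin 3 → ℂ, ContMDiff (𝓡 2) 𝓘(ℝ, Fin 3 → ℂ) ∞ φ →
        Integrable (fun x => ((Jac q x : ℂ) • (opH κ q g ∘ q) x) ⬝ᵥ star (φ x)) sphereMeasure ∧
        Integrable (fun x => opS κ q (g ∘ q) x *
          conj (matColon ((DS2 q x)ᵀ.map Complex.ofReal) (curlMatS2 φ x))) sphereMeasure ∧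
        ∫ x, ((Jac q x : ℂ) • (opH κ q g ∘ q) x) ⬝ᵥ star (φ x) ∂sphereMeasure =
          ∫ x, opS κ q (g ∘ q) x *
            conj (matColon ((DS2 q x)ᵀ.map Complex.ofReal) (curlMatS2 φ x)) ∂sphereMeasure) := by
  have hq' : SphereContDiff 2 q := .of_contMDiff hq
  refine ⟨fun C α hα0 hα hH => tendstoUniformlyOn_tangentialGradAt κ hq' hinj hJ hg hα0 hα hH,
    fun hU φ hφ => ?_⟩
  have hφ' : SphereContDiff 1 φ := (SphereContDiff.of_contMDiff hφ).of_le (by norm_cast)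
  have hφj : ∀ j, SphereContDiff 1 fun y => φ y j := fun j =>
    hφ'.clm_comp (ContinuousLinearMap.proj (R := ℝ) (φ := fun _ : Fin 3 => ℂ) j)
  have hfj : ∀ j, SphereContDiff 1 fun y => star (φ y) j := fun j =>
    (hφj j).clm_comp (Complex.conjCLE : ℂ →L[ℝ] ℂ)
  obtain ⟨hHc, hVc, h⟩ := continuous_opH_and_integral_eq κ hq' hinj hJ hg hU hfj
  have hfc : Continuous fun x => star (φ x) := continuous_pi fun j => (hfj j).continuous
  have hJc : Continuous fun x => (Jac q x : ℂ) :=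
    Complex.continuous_ofReal.comp (continuous_Jac hq')
  have hEc : Continuous fun x => curlPairing q (fun y => star (φ y)) 0 x :=
    continuous_curlPairing_const hq' hJ (f := fun y => star (φ y)) hfj 0
  have h1 : ∀ x, ((Jac q x : ℂ) • (opH κ q g ∘ q) x) ⬝ᵥ star (φ x) =
      (Jac q x : ℂ) * (opH κ q g (q x) ⬝ᵥ star (φ x)) := fun x => smul_dotProduct _ _ _
  have h2 : ∀ x, opS κ q (g ∘ q) x *
      conj (matColon ((DS2 q x)ᵀ.map Complex.ofReal) (curlMatS2 φ x)) =
        2 * (layerPotential κ q g (q x) * curlPairing q (fun y => star (φ y)) 0 x) := fun x => by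
    rw [conj_matColon_eq hφj, opS_eq_layerPotential κ hq' hinj, mul_assoc]
  -- Both integrands are now continuous on the compact sphere, which gives absolute convergence.
  rw [funext h1, funext h2, h, integral_const_mul]
  exact ⟨(hJc.fun_mul (hHc.dotProduct_fin hfc)).integrable_sphere,
    (continuous_const.fun_mul (hVc.fun_mul hEc)).integrable_sphere, rfl⟩
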